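/- **Model.** Let $(A_t,B_t,U_t,V_t)_{t\ge 1}$ be i.i.d. (over $t$) random vectors in $\mathbb R^4$ with $U_t\le V_t$ a.s., and suppose that for some $p\ge 2$ we have $\mathbb E|A_t|^p<1$ and $\mathbb E|B_t|^p+\mathbb E|U_t|^p+\mathbb E|V_t|^p<\infty$. After the action $P_{t-1}$ the feasible interval is $I_t=[A_tP_{t-1}+B_t+U_t,\;A_tP_{t-1}+B_t+V_t]$. An admissible policy, possibly randomized and history-dependent, chooses $P_t\in I_t$ a.s. using past and current information, where the next vector $(A_{t+1},B_{t+1},U_{t+1},V_{t+1})$ is independent of the information available at time $t$. Its cost is $\limsup_{T\to\infty}\frac1T\sum_{t=1}^T\mathbb E[c(P_{t-1},P_t)]$. The adjustment cost $c:\mathbb R^2\to[0,\infty)$ is jointly convex, $C^2$, and strictly convex in $y$; $c(x,x)=0$ and $\nabla c(x,x)=0$; $\partial_y c(x,y)>0$ for $y>x$ and $\partial_y c(x,y)<0$ for $y<x$; and $c(x,y)\le K(1+|x|^p+|y|^p)$ for some $K>0$ and all $x,y$. Assume moreover that there is at most one point $x\in\mathbb R$ with $x\in[A_1x+B_1+U_1,\,A_1x+B_1+V_1]$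 almost surely (at most one action can be kept forever with certainty). A *relative value function* is a convex $h:\mathbb R\to\mathbb R$ with $|h(x)|\le C(1+|x|^p)$ for some $C$ that solves, with some constant $\lambda\in\mathbb R$, $$\lambda+h(x)=\mathbb E\Big[\min_{y\in I(x)}\{c(x,y)+h(y)\}\Big]\quad\text{for all }x,\qquad I(x)=[A_1x+B_1+U_1,\,A_1x+B_1+V_1].$$ The corresponding *optimal target function* is $r(x)=\arg\min_{z\in\mathbb R}\{c(x,z)+h(z)\}$. **Theorem (Non-expansiveness of optimal reference rules).** Assume in addition that $c_{xy}(x,y)<0$ and $|c_{xy}(x,y)|\le c_{yy}(x,y)$ for all $x,y$. Then a relative value function exists, and for every relative value function $h$ the following hold. The minimizer $r(x)$ exists and is unique for every $x$, and the reference rule that projects $r(P_{t-1})$ onto $I_t$ minimizes the long-run average cost among all admissible policies, from every initial action $P_0=x$. The function $r$ is strictly increasing and non-expansive: for all $p_1<p_2$, $$0\le r(p_2)-r(p_1)<p_2-p_1 .$$ Moreover $r$ has a unique fixed point $p^*$, and $p^*$ is the unique minimizer of $h$. -/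

import Mathlib

open MeasureTheory ProbabilityTheory Filter Set
open scoped ENNReal

namespace ReferenceRule

/-- The random coefficients of the model. The `n`-th quadruple `(A n, B n, U n, V n)` determines
the feasible interval of period `n + 1`, given the action of period `n`. -/
structure Shocks (Ω : Type*) where
  A : ℕ → Ω → ℝ
  B : ℕ → Ω → ℝ
  U : ℕ → Ω → ℝ
  V : ℕ → Ω → ℝ

namespace Shocks

variable {Ω : Type*}

/-- The `n`-th quadruple of coefficients, as one random vector. -/
def vec (S : Shocks Ω) (n : ℕ) (ω : Ω) : ℝ × ℝ × ℝ × ℝ :=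
  (S.A n ω, S.B n ω, S.U n ω, S.V n ω)

/-- Lower end of the feasible interval that follows the action `x`. -/
def lower (S : Shocks Ω) (n : ℕ) (x : ℝ) (ω : Ω) : ℝ :=
  S.A n ω * x + S.B n ω + S.U n ω

/-- Upper end of the feasible interval that follows the action `x`. -/
def upper (S : Shocks Ω) (n : ℕ) (x : ℝ) (ω : Ω) : ℝ :=
  S.A n ω * x + S.B n ω + S.V n ω

/-- The feasible interval `A x + B + [U, V]` that follows the action `x`. -/
def feasible (S : Shocks Ω) (n : ℕ) (x : ℝ) (ω : Ω) : Set ℝ :=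
  Icc (S.lower n x ω) (S.upper n x ω)

end Shocks

variable {Ω : Type*} {mΩ : MeasurableSpace Ω}

/-- Transition dynamics: the quadruples `(A, B, U, V)` are i.i.d. over time and `[U, V]` is an
interval. The sigma-algebra `𝓕 n` is the information after the action of period `n`; it may contain
randomness that is unrelated to the coefficients, so that randomized history-dependent decisions
are `𝓕`-adapted. The next quadruple is independent of it. -/
structure TransitionDynamics (μ : Measure Ω) (𝓕 : Filtration ℕ mΩ) (S : Shocks Ω) : Prop where
  adapted : ∀ n, Measurable[𝓕 (n + 1)] (S.vec n)
  indep : ∀ n, Indep (MeasurableSpace.comap (S.vec n) inferInstance) (𝓕 n) μ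
  identDistrib : ∀ n, IdentDistrib (S.vec n) (S.vec 0) μ μ
  interval : ∀ n, ∀ᵐ ω ∂μ, S.U n ω ≤ S.V n ω

/-- `L^p`-stability: `E|A|^p < 1` and `B, U, V` have finite `p`-th moments. -/
structure LpStable (μ : Measure Ω) (S : Shocks Ω) (p : ℝ) : Prop where
  two_le : 2 ≤ p
  integrable_A : Integrable (fun ω => |S.A 0 ω| ^ p) μ
  integral_A_lt : ∫ ω, |S.A 0 ω| ^ p ∂μ < 1
  integrable_B : Integrable (fun ω => |S.B 0 ω| ^ p) μ
  integrable_U : Integrable (fun ω => |S.U 0 ω| ^ p) μ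
  integrable_V : Integrable (fun ω => |S.V 0 ω| ^ p) μ

/-- The standing assumptions on the adjustment cost `c x y` (`x` the previous action, `y` the
current one). -/
structure AdjustmentCost (p : ℝ) (c : ℝ → ℝ → ℝ) : Prop where
  nonneg : ∀ x y, 0 ≤ c x y
  convex : ConvexOn ℝ univ (fun z : ℝ × ℝ => c z.1 z.2)
  contDiff : ContDiff ℝ 2 (fun z : ℝ × ℝ => c z.1 z.2)
  strictConvex : ∀ x, StrictConvexOn ℝ univ (c x)
  diag : ∀ x, c x x = 0
  grad_diag : ∀ x, fderiv ℝ (fun z : ℝ × ℝ => c z.1 z.2) (x, x) = 0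
  deriv_pos : ∀ x y, x < y → 0 < deriv (c x) y
  deriv_neg : ∀ x y, y < x → deriv (c x) y < 0
  growth : ∃ K > 0, ∀ x y, c x y ≤ K * (1 + |x| ^ p + |y| ^ p)

/-- The mixed second derivative `c_{xy}`. -/
noncomputable def costXY (c : ℝ → ℝ → ℝ) (x y : ℝ) : ℝ :=
  deriv (fun s => deriv (fun t => c s t) y) x

/-- The second derivative `c_{yy}`. -/
noncomputable def costYY (c : ℝ → ℝ → ℝ) (x y : ℝ) : ℝ :=
  deriv (fun t => deriv (fun s => c x s) t) y

/-- An admissible action process started at `x`: it is adapted (so it may depend on the whole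
history, on the interval just observed, and on extra randomization), and each action is almost
surely feasible. -/
structure IsAdmissible (μ : Measure Ω) (𝓕 : Filtration ℕ mΩ) (S : Shocks Ω) (x : ℝ)
    (P : ℕ → Ω → ℝ) : Prop where
  initial : ∀ᵐ ω ∂μ, P 0 ω = x
  adapted : ∀ n, Measurable[𝓕 n] (P n)
  feasible : ∀ n, ∀ᵐ ω ∂μ, P (n + 1) ω ∈ S.feasible n (P n ω) ω

/-- The long-run average adjustment cost
`limsup_T (1/T) ∑_{t=1}^T E[c(P_{t-1}, P_t)]`, with values in `[0, ∞]`. -/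
noncomputable def longRunCost (μ : Measure Ω) (c : ℝ → ℝ → ℝ) (P : ℕ → Ω → ℝ) : ℝ≥0∞ :=
  limsup (fun T : ℕ =>
    (∑ t ∈ Finset.range T, ∫⁻ ω, ENNReal.ofReal (c (P t ω) (P (t + 1) ω)) ∂μ) / (T : ℝ≥0∞)) atTop

/-- The action process of the reference rule with target function `r`, started at `x`: the next
action is the projection of `r (P n)` onto the feasible interval. -/
def rulePath (S : Shocks Ω) (r : ℝ → ℝ) (x : ℝ) : ℕ → Ω → ℝ
  | 0, _ => x
  | n + 1, ω =>
    min (max (r (rulePath S r x n ω)) (S.lower n (rulePath S r x n ω) ω))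
      (S.upper n (rulePath S r x n ω) ω)

/-- The reference rule with target `r` minimizes the long-run average cost among all admissible
action processes, from every initial action. -/
def IsOptimalRule (μ : Measure Ω) (𝓕 : Filtration ℕ mΩ) (S : Shocks Ω) (c : ℝ → ℝ → ℝ)
    (r : ℝ → ℝ) : Prop :=
  ∀ x, IsAdmissible μ 𝓕 S x (rulePath S r x) ∧
    ∀ P, IsAdmissible μ 𝓕 S x P → longRunCost μ c (rulePath S r x) ≤ longRunCost μ c P

/-- `min_{y ∈ I(x)} {c(x, y) + h(y)}` for the realized feasible interval `I(x)`. -/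
noncomputable def stepValue (S : Shocks Ω) (c : ℝ → ℝ → ℝ) (h : ℝ → ℝ) (x : ℝ) (ω : Ω) : ℝ :=
  sInf ((fun y => c x y + h y) '' S.feasible 0 x ω)

/-- `h` is a relative value function with average cost `lam`: a convex function of polynomial
growth of order `p` that solves the average cost optimality equation
`lam + h(x) = E[min_{y ∈ I(x)} {c(x, y) + h(y)}]`. -/
structure IsRelativeValue (μ : Measure Ω) (S : Shocks Ω) (p : ℝ) (c : ℝ → ℝ → ℝ) (lam : ℝ)
    (h : ℝ → ℝ) : Prop where
  convex : ConvexOn ℝ univ h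
  growth : ∃ C, ∀ x, |h x| ≤ C * (1 + |x| ^ p)
  integrable : ∀ x, Integrable (stepValue S c h x) μ
  optimality : ∀ x, lam + h x = ∫ ω, stepValue S c h x ω ∂μ

/-- `r` is the target function that belongs to `h`: `r x` is the unique minimizer of
`z ↦ c(x, z) + h(z)` over the whole line. -/
def IsTarget (c : ℝ → ℝ → ℝ) (h r : ℝ → ℝ) : Prop :=
  ∀ x z, z ≠ r x → c x (r x) + h (r x) < c x z + h z

end ReferenceRule

open ReferenceRule

/-!
# Non-expansiveness of optimal reference rules

**The cost.** A jointly convex function that vanishes on the diagonal is constant along all parallels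
to the diagonal, so `c x y = f (y - x)` with `f` strictly convex (`AdjustmentCost.eq_increment`).
The rest of the argument concerns such costs. Throughout, `T h x` is the expected minimum of
`f (y - x) + h y` over the feasible interval that follows `x` (`bellman`).

**Existence.** An action that is feasible after `x'` becomes feasible after `x` when it is moved by
`A (x - x')`. As `E|A|^p < 1`, this coupling gives a bound on the increments of `h`, of order
`|x - x'| (k + |x| + |x'|) ^ (p - 1)`, that `T` preserves (`exists_tame_bellman`). The normalized
solutions of the discounted equations all satisfy it, so a subsequence converges as the discount
factor tends to `1`, and `T` is continuous along it (`exists_isRelativeValue`).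

**Regularity.** Let `h` be any relative value function. It is coercive: if it were decreasing
towards infinity, say, then far out the adjustment cost of being pushed back towards the origin would
contradict the optimality equation (`IsRelativeValue.not_antitone_direction`). It is differentiable:
by the same coupling the jump of `h'` at `x` is at most the expectation of `|A|` times the jump at
the next action, which is a contraction in a weighted norm (`IsRelativeValue.differentiable`).

**The target function.** Coercivity gives the unique minimizer `r x` of `f (y - x) + h y`. Exchange
arguments show that `r` is monotone and `1`-Lipschitz, differentiability of `h` makes it strictly
monotone, and its fixed points are the minimizers of `h`. An equality `r p₂ - r p₁ = p₂ - p₁` would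
force `h` to be affine between `r p₁` and `r p₂`.

**No affine pieces.** On an affine piece of `h` the optimality equation and the strict convexity of
`f` force the next actions from its two ends to keep their distance. Where `A < 1`, this is possible
only if both follow `r`; so `r` maps affine pieces to affine pieces of the same length. Iterating,
the minimizers of `h` form a nondegenerate interval `[a, b]`. If the ends are not kept forever, some
shock moves them by a common nonzero amount, whereas the iterates of `r` must bring the moved ends
back to `a` and `b`; that contradicts monotonicity (`IsTarget.not_midAffine`).

**Optimality.** The `p`-th moments stay bounded under every admissible process, so the telescoped
optimality equation shows that every process has average cost at least `lam`, with equality for the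
reference rule (`IsTarget.isOptimalRule`).
-/

namespace ReferenceRule

open scoped Topology

/-! ### Convex functions on the line -/

section Convex

variable {h : ℝ → ℝ}

theorem continuous_of_convexOn_univ (hh : ConvexOn ℝ univ h) : Continuous h :=
  continuousOn_univ.1 (hh.continuousOn isOpen_univ)

theorem convexOn_univ_le (hh : ConvexOn ℝ univ h) (x y : ℝ) {t : ℝ} (h0 : 0 ≤ t) (h1 : t ≤ 1) :
    h ((1 - t) * x + t * y) ≤ (1 - t) * h x + t * h y := by
  simpa using hh.2 (mem_univ x) (mem_univ y) (sub_nonneg.2 h1) h0 (by ring)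

theorem convexOn_univ_midpoint (hh : ConvexOn ℝ univ h) (x y : ℝ) :
    h ((x + y) / 2) ≤ (h x + h y) / 2 := by
  have := convexOn_univ_le hh x y (t := 1 / 2) (by norm_num) (by norm_num)
  convert this using 2 <;> ring

theorem exists_support_line (hh : ConvexOn ℝ univ h) (x : ℝ) :
    ∃ m, ∀ z, h x + m * (z - x) ≤ h z := by
  refine ⟨derivWithin h (Ioi x) x, fun z => ?_⟩
  have hx : x ∈ interior (univ : Set ℝ) := by simp
  rcases lt_trichotomy z x with hz | rfl | hz
  · have h1 := hh.slope_le_leftDeriv_of_mem_interior (mem_univ z) hx hz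
    have h2 := hh.leftDeriv_le_rightDeriv_of_mem_interior hx
    have h3 := h1.trans h2
    rw [slope_def_field, div_le_iff₀ (sub_pos.2 hz)] at h3
    nlinarith
  · simp
  · have h1 := hh.rightDeriv_le_slope_of_mem_interior hx (mem_univ z) hz
    rw [slope_def_field, le_div_iff₀ (sub_pos.2 hz)] at h1
    linarith

/-- A convex function on the line that is neither monotone nor antitone attains its minimum, and
its minimizers form a bounded set. -/
theorem exists_min_of_not_monotone (hh : ConvexOn ℝ univ h) (h1 : ¬ Antitone h)
    (h2 : ¬ Monotone h) :
    (∃ q, ∀ y, h q ≤ h y) ∧ ∃ lo hi, ∀ q, (∀ y, h q ≤ h y) → q ∈ Icc lo hi := by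
  simp only [Antitone, Monotone, not_forall, not_le] at h1 h2
  obtain ⟨u, v, huv, hlt⟩ := h1
  obtain ⟨u', v', huv', hlt'⟩ := h2
  have right : ∀ z, v ≤ z → h v ≤ h z := fun z hz => by
    have := hh.le_max_of_mem_Icc (mem_univ u) (mem_univ z) ⟨huv, hz⟩
    rcases le_max_iff.1 this with h' | h'
    · linarith
    · exact h'
  have left : ∀ z, z ≤ u' → h u' ≤ h z := fun z hz => by
    have := hh.le_max_of_mem_Icc (mem_univ z) (mem_univ v') ⟨hz, huv'⟩
    rcases le_max_iff.1 this with h' | h'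
    · exact h'
    · linarith
  constructor
  · obtain ⟨q, -, hq⟩ := (isCompact_Icc (a := min u' u) (b := max v v')).exists_isMinOn
      ⟨u, by simp, by simp [huv]⟩ (continuous_of_convexOn_univ hh).continuousOn
    have hq' : ∀ y ∈ Icc (min u' u) (max v v'), h q ≤ h y := hq
    have hu := hq' u ⟨by simp, by simp [huv]⟩
    have hv' := hq' v' ⟨by simp [huv'], by simp⟩
    refine ⟨q, fun y => ?_⟩
    rcases le_total y (min u' u) with hy | hy
    · have := left y (hy.trans (min_le_left _ _)); linarith
    · rcases le_total y (max v v') with hy2 | hy2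
      · exact hq' y ⟨hy, hy2⟩
      · have := right y ((le_max_left _ _).trans hy2); linarith
  · refine ⟨u', v, fun q hq => ⟨?_, ?_⟩⟩
    · by_contra! hlt2
      have := left q hlt2.le
      have := hq v'
      linarith
    · by_contra! hlt2
      have := right q hlt2.le
      have := hq u
      linarith

/-- The jump of the derivative of a convex function at `x`. -/
noncomputable def kink (h : ℝ → ℝ) (x : ℝ) : ℝ :=
  derivWithin h (Ioi x) x - derivWithin h (Iio x) x

/-- The second difference quotient of `h` at `x`, with step `t`. -/
noncomputable def secondDiff (h : ℝ → ℝ) (x t : ℝ) : ℝ :=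
  (h (x + t) + h (x - t) - 2 * h x) / t

theorem secondDiff_eq (h : ℝ → ℝ) (x : ℝ) {t : ℝ} (ht : t ≠ 0) :
    secondDiff h x t = slope h x (x + t) - slope h x (x - t) := by
  rw [secondDiff, slope_def_field, slope_def_field, add_sub_cancel_left,
    show x - t - x = -t by ring]
  field_simp
  ring

theorem tendsto_secondDiff (hh : ConvexOn ℝ univ h) (x : ℝ) :
    Tendsto (secondDiff h x) (𝓝[>] 0) (𝓝 (kink h x)) := by
  have hx : x ∈ interior (univ : Set ℝ) := by simp
  have h1 := (hasDerivWithinAt_iff_tendsto_slope' self_notMem_Ioi).1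
    (hh.hasDerivWithinAt_rightDeriv_of_mem_interior hx)
  have h2 := (hasDerivWithinAt_iff_tendsto_slope' self_notMem_Iio).1
    (hh.hasDerivWithinAt_leftDeriv_of_mem_interior hx)
  have h3 : Tendsto (fun t : ℝ => x + t) (𝓝[>] 0) (𝓝[>] x) := by
    refine tendsto_nhdsWithin_iff.2 ⟨?_, ?_⟩
    · have : Tendsto (fun t : ℝ => x + t) (𝓝 0) (𝓝 (x + 0)) := by
        exact (continuous_const.add continuous_id).tendsto 0
      simpa using this.mono_left nhdsWithin_le_nhds
    · filter_upwards [self_mem_nhdsWithin] with t ht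
      simpa using ht
  have h4 : Tendsto (fun t : ℝ => x - t) (𝓝[>] 0) (𝓝[<] x) := by
    refine tendsto_nhdsWithin_iff.2 ⟨?_, ?_⟩
    · have : Tendsto (fun t : ℝ => x - t) (𝓝 0) (𝓝 (x - 0)) := by
        exact (continuous_const.sub continuous_id).tendsto 0
      simpa using this.mono_left nhdsWithin_le_nhds
    · filter_upwards [self_mem_nhdsWithin] with t ht
      simpa using ht
  refine ((h1.comp h3).sub (h2.comp h4)).congr' ?_
  filter_upwards [self_mem_nhdsWithin] with t ht
  exact (secondDiff_eq h x (ne_of_gt ht)).symm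

theorem kink_le_secondDiff (hh : ConvexOn ℝ univ h) (x : ℝ) {t : ℝ} (ht : 0 < t) :
    kink h x ≤ secondDiff h x t := by
  have hx : x ∈ interior (univ : Set ℝ) := by simp
  rw [secondDiff_eq h x ht.ne', kink, slope_comm h x (x - t)]
  have h1 := hh.rightDeriv_le_slope_of_mem_interior hx (mem_univ (x + t)) (by linarith)
  have h2 := hh.slope_le_leftDeriv_of_mem_interior (mem_univ (x - t)) hx (by linarith)
  linarith

theorem kink_nonneg (hh : ConvexOn ℝ univ h) (x : ℝ) : 0 ≤ kink h x := by
  have := hh.leftDeriv_le_rightDeriv_of_mem_interior (x := x) (by simp)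
  rw [kink]; linarith

theorem secondDiff_nonneg (hh : ConvexOn ℝ univ h) (x : ℝ) {t : ℝ} (ht : 0 < t) :
    0 ≤ secondDiff h x t :=
  (kink_nonneg hh x).trans (kink_le_secondDiff hh x ht)

theorem secondDiff_mono (hh : ConvexOn ℝ univ h) (x : ℝ) {s t : ℝ} (hs : 0 < s) (hst : s ≤ t) :
    secondDiff h x s ≤ secondDiff h x t := by
  have ht : 0 < t := hs.trans_le hst
  have e1 := convexOn_univ_le hh x (x + t) (t := s / t) (by positivity) (by rwa [div_le_one ht])
  have e2 := convexOn_univ_le hh x (x - t) (t := s / t) (by positivity) (by rwa [div_le_one ht])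
  have r1 : (1 - s / t) * x + s / t * (x + t) = x + s := by field_simp; ring
  have r2 : (1 - s / t) * x + s / t * (x - t) = x - s := by field_simp; ring
  rw [r1] at e1
  rw [r2] at e2
  rw [secondDiff, secondDiff, div_le_iff₀ hs]
  have : (h (x + t) + h (x - t) - 2 * h x) / t * s
      = s / t * h (x + t) + s / t * h (x - t) - 2 * (s / t) * h x := by
    field_simp
  rw [this]
  linarith

theorem differentiableAt_of_kink_eq_zero (hh : ConvexOn ℝ univ h) {x : ℝ} (hk : kink h x = 0) :
    DifferentiableAt ℝ h x := by
  have hx : x ∈ interior (univ : Set ℝ) := by simp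
  have h1 := hh.hasDerivWithinAt_rightDeriv_of_mem_interior hx
  have h2 := hh.hasDerivWithinAt_leftDeriv_of_mem_interior hx
  rw [kink, sub_eq_zero] at hk
  rw [← hk] at h2
  have h3 := h2.union h1
  have : HasDerivAt h (derivWithin h (Ioi x) x) x := by
    rw [hasDerivAt_iff_tendsto_slope]
    rw [hasDerivWithinAt_iff_tendsto_slope] at h3
    simpa [Iio_union_Ioi] using h3
  exact this.differentiableAt

theorem kink_eq_zero_of_differentiableAt {x : ℝ} (hd : DifferentiableAt ℝ h x) :
    kink h x = 0 := by
  rw [kink, hd.derivWithin (uniqueDiffWithinAt_Ioi x),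
    hd.derivWithin (uniqueDiffWithinAt_Iio x), sub_self]

/-- The second difference quotients along a scaled step `A t` converge to `|A|` times the kink. -/
theorem tendsto_secondDiff_scaled (hh : ConvexOn ℝ univ h) (y A : ℝ) :
    Tendsto (fun t => (h (y + A * t) + h (y - A * t) - 2 * h y) / t) (𝓝[>] 0)
      (𝓝 (|A| * kink h y)) := by
  rcases eq_or_ne A 0 with rfl | hA
  · have : (fun t : ℝ => (h (y + 0 * t) + h (y - 0 * t) - 2 * h y) / t) = fun _ => 0 := by
      funext t; simp; left; ring
    rw [this]; simp
  · have hA' : 0 < |A| := abs_pos.2 hA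
    have h3 : Tendsto (fun t : ℝ => |A| * t) (𝓝[>] 0) (𝓝[>] 0) := by
      refine tendsto_nhdsWithin_iff.2 ⟨?_, ?_⟩
      · have : Tendsto (fun t : ℝ => |A| * t) (𝓝 0) (𝓝 (|A| * 0)) :=
          (continuous_const.mul continuous_id).tendsto 0
        simpa using this.mono_left nhdsWithin_le_nhds
      · filter_upwards [self_mem_nhdsWithin] with t ht
        exact mul_pos hA' ht
    refine (((tendsto_secondDiff hh y).comp h3).const_mul |A|).congr' ?_
    filter_upwards [self_mem_nhdsWithin] with t ht
    have ht' : t ≠ 0 := ne_of_gt ht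
    simp only [Function.comp, secondDiff]
    have : h (y + |A| * t) + h (y - |A| * t) = h (y + A * t) + h (y - A * t) := by
      rcases abs_cases A with ⟨e, -⟩ | ⟨e, -⟩
      · rw [e]
      · rw [e, neg_mul, sub_neg_eq_add, ← sub_eq_add_neg, add_comm]
    rw [this]
    field_simp

end Convex

/-! ### The adjustment cost as a function of the increment -/

/-- A cost of the increment `z = y - x`: strictly convex, differentiable, vanishing exactly at `0`,
of polynomial growth of order `p`. -/
structure IncrementCost (p : ℝ) (f : ℝ → ℝ) : Prop where
  strictConvex : StrictConvexOn ℝ univ f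
  differentiable : Differentiable ℝ f
  zero : f 0 = 0
  nonneg : ∀ z, 0 ≤ f z
  growth : ∃ K > 0, ∀ z, f z ≤ K * (1 + |z|) ^ p

/-- A convex function on the plane that vanishes on the diagonal is constant along all lines
parallel to the diagonal. Indeed `(x, y)` lies on the segment between `(z, z + (y - x) / t)` and a
point of the diagonal, with weight `t` at the former, for every `t < 1`. -/
theorem AdjustmentCost.le_translate {p : ℝ} {c : ℝ → ℝ → ℝ} (hc : AdjustmentCost p c)
    (x y z : ℝ) : c x y ≤ c z (z + (y - x)) := by
  have key : ∀ t ∈ Ioo (0 : ℝ) 1, c x y ≤ c z (z + (y - x) / t) := by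
    rintro t ⟨h0, h1⟩
    have h1' : (0 : ℝ) < 1 - t := by linarith
    set w := (x - t * z) / (1 - t) with hw
    have hw' : (1 - t) * w = x - t * z := by rw [hw]; field_simp
    have := hc.convex.2 (mem_univ (z, z + (y - x) / t)) (mem_univ (w, w)) h0.le h1'.le (by ring)
    simp only [Prod.smul_mk, Prod.mk_add_mk, smul_eq_mul, hc.diag, mul_zero, add_zero] at this
    have e1 : t * z + (1 - t) * w = x := by rw [hw']; ring
    have e2 : t * (z + (y - x) / t) + (1 - t) * w = y := by
      rw [hw']; field_simp; ring
    rw [e1, e2] at this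
    have hn := hc.nonneg z (z + (y - x) / t)
    nlinarith
  have hcont : Continuous fun z : ℝ × ℝ => c z.1 z.2 := hc.contDiff.continuous
  have hlim : Tendsto (fun t : ℝ => c z (z + (y - x) / t)) (𝓝[<] 1) (𝓝 (c z (z + (y - x)))) := by
    have : ContinuousAt (fun t : ℝ => c z (z + (y - x) / t)) 1 := by
      refine hcont.continuousAt.comp (f := fun t : ℝ => (z, z + (y - x) / t)) ?_
      exact continuousAt_const.prodMk
        (continuousAt_const.add (continuousAt_const.div continuousAt_id one_ne_zero))
    simpa using this.tendsto.mono_left nhdsWithin_le_nhds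
  refine ge_of_tendsto hlim ?_
  filter_upwards [Ioo_mem_nhdsLT (zero_lt_one (α := ℝ))] with t ht using key t ht

theorem AdjustmentCost.eq_increment {p : ℝ} {c : ℝ → ℝ → ℝ} (hc : AdjustmentCost p c) :
    c = fun x y => c 0 (y - x) := by
  funext x y
  apply le_antisymm
  · simpa using hc.le_translate x y 0
  · simpa using hc.le_translate 0 (y - x) x

theorem AdjustmentCost.incrementCost {p : ℝ} {c : ℝ → ℝ → ℝ} (hp : 2 ≤ p)
    (hc : AdjustmentCost p c) : IncrementCost p (c 0) where
  strictConvex := hc.strictConvex 0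
  differentiable := by
    have h1 : ContDiff ℝ 2 (fun y : ℝ => ((0 : ℝ), y)) := contDiff_prodMk_right 0
    exact (hc.contDiff.comp h1).differentiable (by norm_num)
  zero := hc.diag 0
  nonneg := hc.nonneg 0
  growth := by
    obtain ⟨K, hK, hb⟩ := hc.growth
    refine ⟨2 * K, by positivity, fun z => (hb 0 z).trans ?_⟩
    have h1 : |z| ^ p ≤ (1 + |z|) ^ p :=
      Real.rpow_le_rpow (abs_nonneg z) (by linarith [abs_nonneg z]) (by linarith)
    have h2 : 1 ≤ (1 + |z|) ^ p :=
      Real.one_le_rpow (by linarith [abs_nonneg z]) (by linarith)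
    rw [abs_zero, Real.zero_rpow (by linarith)]
    nlinarith

namespace IncrementCost

variable {p : ℝ} {f : ℝ → ℝ}

theorem convex (hf : IncrementCost p f) : ConvexOn ℝ univ f := hf.strictConvex.convexOn

theorem continuous (hf : IncrementCost p f) : Continuous f := hf.differentiable.continuous

theorem pos (hf : IncrementCost p f) {z : ℝ} (hz : z ≠ 0) : 0 < f z := by
  have := hf.strictConvex.2 (mem_univ 0) (mem_univ z) hz.symm
    (show (0 : ℝ) < 1 / 2 by norm_num) (show (0 : ℝ) < 1 / 2 by norm_num) (by norm_num)
  have h1 := hf.nonneg ((1 / 2 : ℝ) • 0 + (1 / 2 : ℝ) • z)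
  simp only [smul_eq_mul, hf.zero] at this h1
  linarith

theorem exists_linear_lower (hf : IncrementCost p f) : ∃ ε > 0, ∀ z, ε * (|z| - 1) ≤ f z := by
  have aux : ∀ s : ℝ, |s| = 1 → ∀ t : ℝ, 0 ≤ t → f s * (t - 1) ≤ f (t * s) := by
    intro s hs t ht
    rcases le_total t 1 with h1 | h1
    · have := hf.nonneg s
      have := hf.nonneg (t * s)
      nlinarith
    · have := convexOn_univ_le hf.convex 0 (t * s) (t := 1 / t) (by positivity)
        (by rw [div_le_one (by linarith)]; exact h1)
      have e : (1 - 1 / t) * 0 + 1 / t * (t * s) = s := by field_simp; ring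
      rw [e, hf.zero, mul_zero, zero_add, one_div, ← div_eq_inv_mul,
        le_div_iff₀ (by linarith)] at this
      have := hf.nonneg s
      nlinarith
  refine ⟨min (f 1) (f (-1)), lt_min (hf.pos one_ne_zero) (hf.pos (by norm_num)), fun z => ?_⟩
  rcases le_total |z| 1 with h1 | h1
  · have := hf.nonneg z
    have : 0 ≤ min (f 1) (f (-1)) := le_min (hf.nonneg _) (hf.nonneg _)
    nlinarith
  · rcases le_total 0 z with hz | hz
    · have := aux 1 (by simp) z hz
      rw [mul_one] at this
      rw [abs_of_nonneg hz] at h1 ⊢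
      exact (mul_le_mul_of_nonneg_right (min_le_left _ _) (by linarith)).trans this
    · have := aux (-1) (by simp) (-z) (by linarith)
      rw [mul_neg_one, neg_neg] at this
      rw [abs_of_nonpos hz] at h1 ⊢
      exact (mul_le_mul_of_nonneg_right (min_le_right _ _) (by linarith)).trans this

/-- Increments of `f` are bounded by the slope of a longer secant. -/
theorem exists_sub_le (hf : IncrementCost p f) (hp : 2 ≤ p) :
    ∃ C > 0, ∀ d e, f (d + e) - f d ≤ C * |e| * (1 + |d| + |e|) ^ (p - 1) := by
  obtain ⟨K, hK, hb⟩ := hf.growth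
  refine ⟨K * 2 ^ p, by positivity, fun d e => ?_⟩
  rcases eq_or_ne e 0 with rfl | he
  · simp
  set s := 1 + |d| + |e| with hs
  have he' : 0 < |e| := abs_pos.2 he
  have hd := abs_nonneg d
  have hs0 : 0 < s := by positivity
  have hconv := convexOn_univ_le hf.convex d (d + s / |e| * e) (t := |e| / s) (by positivity)
    (by rw [div_le_one hs0]; linarith)
  have e1 : (1 - |e| / s) * d + |e| / s * (d + s / |e| * e) = d + e := by field_simp; ring
  rw [e1] at hconv
  have habs : 1 + |d + s / |e| * e| ≤ 2 * s := by
    have h1 := abs_add_le d (s / |e| * e)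
    rw [abs_mul, abs_div, abs_abs, abs_of_pos hs0, div_mul_cancel₀ _ he'.ne'] at h1
    linarith
  have h2 : f (d + s / |e| * e) ≤ K * (2 ^ p * s ^ p) := by
    refine (hb _).trans ?_
    rw [← Real.mul_rpow (by norm_num) hs0.le]
    gcongr
  have h3 : s ^ p = s ^ (p - 1) * s := by
    rw [← Real.rpow_add_one hs0.ne']; ring_nf
  have hfd := hf.nonneg d
  have h4 : |e| / s * f (d + s / |e| * e) ≤ |e| / s * (K * (2 ^ p * s ^ p)) := by gcongr
  have h5 : |e| / s * (K * (2 ^ p * s ^ p)) = K * 2 ^ p * |e| * s ^ (p - 1) := by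
    rw [h3]; field_simp
  have h6 : 0 ≤ |e| / s * f d := by positivity
  linarith

end IncrementCost

variable {Ω : Type*} {mΩ : MeasurableSpace Ω}

/-! ### Norm estimates -/

section Lp

variable {μ : Measure Ω} {p : ℝ}

theorem lpNorm_rpow_eq (hp : 0 < p) {X : Ω → ℝ} (hX : AEStronglyMeasurable X μ) :
    lpNorm X (ENNReal.ofReal p) μ ^ p = ∫ ω, |X ω| ^ p ∂μ := by
  rw [lpNorm_eq_integral_norm_rpow_toReal (by simpa using hp) (by simp) hX,
    ENNReal.toReal_ofReal hp.le, ← Real.rpow_mul (by positivity), inv_mul_cancel₀ hp.ne',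
    Real.rpow_one]
  rfl

theorem integrable_rpow_of_memLp (hp : 0 < p) {X : Ω → ℝ}
    (hX : MemLp X (ENNReal.ofReal p) μ) : Integrable (fun ω => |X ω| ^ p) μ := by
  have := hX.integrable_norm_rpow (by simpa using hp) (by simp)
  simpa [ENNReal.toReal_ofReal hp.le] using this

theorem lpNorm_mono_ae {X Y : Ω → ℝ} {q : ℝ≥0∞} (hX : AEStronglyMeasurable X μ)
    (hY : MemLp Y q μ) (h : ∀ᵐ ω ∂μ, |X ω| ≤ Y ω) :
    lpNorm X q μ ≤ lpNorm Y q μ := by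
  rw [← toReal_eLpNorm hX, ← toReal_eLpNorm hY.aestronglyMeasurable]
  exact ENNReal.toReal_mono hY.eLpNorm_ne_top (eLpNorm_mono_ae_real h)

/-- Hölder's inequality for the conjugate exponents `p` and `p / (p - 1)`. -/
theorem integral_mul_rpow_le (hp : 1 < p) {Z X : Ω → ℝ} (hZ : MemLp Z (ENNReal.ofReal p) μ)
    (hX : MemLp X (ENNReal.ofReal p) μ) (hZ0 : ∀ ω, 0 ≤ Z ω) (hX0 : ∀ ω, 0 ≤ X ω) :
    Integrable (fun ω => Z ω * X ω ^ (p - 1)) μ ∧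
      ∫ ω, Z ω * X ω ^ (p - 1) ∂μ ≤
        lpNorm Z (ENNReal.ofReal p) μ * lpNorm X (ENNReal.ofReal p) μ ^ (p - 1) := by
  have hp1 : 0 < p - 1 := by linarith
  have hp0 : 0 < p := by linarith
  have hpq : p.HolderConjugate (p / (p - 1)) := Real.HolderConjugate.conjExponent hp
  have hX' : MemLp (fun ω => X ω ^ (p - 1)) (ENNReal.ofReal (p / (p - 1))) μ := by
    have := hX.norm_rpow_div (ENNReal.ofReal (p - 1))
    rw [ENNReal.toReal_ofReal hp1.le, ← ENNReal.ofReal_div_of_pos hp1] at this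
    refine this.congr_norm ?_ ?_
    · exact (hX.aestronglyMeasurable.aemeasurable.pow_const _).aestronglyMeasurable
    · filter_upwards with ω
      rw [Real.norm_of_nonneg (hX0 ω)]
  refine ⟨?_, ?_⟩
  · have hq : (ENNReal.ofReal p).HolderTriple (ENNReal.ofReal (p / (p - 1))) 1 := by
      refine ⟨?_⟩
      rw [inv_one, ← ENNReal.ofReal_inv_of_pos hp0, ← ENNReal.ofReal_inv_of_pos (by positivity),
        ← ENNReal.ofReal_add (by positivity) (by positivity), hpq.inv_add_inv_eq_one]
      simp
    exact memLp_one_iff_integrable.1 (hX'.mul hZ)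
  · refine (integral_mul_le_Lp_mul_Lq_of_nonneg hpq (ae_of_all _ hZ0)
      (ae_of_all _ fun ω => Real.rpow_nonneg (hX0 ω) _) hZ hX').trans (le_of_eq ?_)
    congr 1
    · rw [lpNorm_eq_integral_norm_rpow_toReal (by simpa using hp0) (by simp)
        hZ.aestronglyMeasurable, ENNReal.toReal_ofReal hp0.le, one_div]
      congr 2
      funext ω
      rw [Real.norm_of_nonneg (hZ0 ω)]
    · rw [lpNorm_eq_integral_norm_rpow_toReal (by simpa using hp0) (by simp)
        hX.aestronglyMeasurable, ENNReal.toReal_ofReal hp0.le, ← Real.rpow_mul (by positivity)]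
      congr 1
      · congr 1
        funext ω
        rw [Real.norm_of_nonneg (hX0 ω), ← Real.rpow_mul (hX0 ω)]
        congr 1
        field_simp
      · field_simp

end Lp

namespace Shocks

/-- The size `|B| + |U| + |V|` of the part of the feasible interval that does not depend on the
previous action. -/
def drift (S : Shocks Ω) (n : ℕ) (ω : Ω) : ℝ := |S.B n ω| + |S.U n ω| + |S.V n ω|

theorem drift_nonneg (S : Shocks Ω) (n : ℕ) (ω : Ω) : 0 ≤ S.drift n ω := by
  unfold drift; positivity

theorem abs_le_of_mem_feasible {S : Shocks Ω} {n : ℕ} {x y : ℝ} {ω : Ω}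
    (hy : y ∈ S.feasible n x ω) : |y| ≤ |S.A n ω| * |x| + S.drift n ω := by
  obtain ⟨h1, h2⟩ := hy
  unfold lower at h1
  unfold upper at h2
  have h3 := abs_le.1 (le_of_eq (abs_mul (S.A n ω) x))
  have hB := abs_le.1 (le_refl |S.B n ω|)
  have hU := abs_le.1 (le_refl |S.U n ω|)
  have hV := abs_le.1 (le_refl |S.V n ω|)
  have hU' := abs_nonneg (S.U n ω)
  have hV' := abs_nonneg (S.V n ω)
  unfold drift
  exact abs_le.2 ⟨by linarith, by linarith⟩

/-- A feasible action can be moved along with the previous action. -/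
theorem add_mem_feasible {S : Shocks Ω} {n : ℕ} {x y : ℝ} {ω : Ω}
    (hy : y ∈ S.feasible n x ω) (t : ℝ) : y + S.A n ω * t ∈ S.feasible n (x + t) ω := by
  obtain ⟨h1, h2⟩ := hy
  unfold lower at h1
  unfold upper at h2
  constructor
  · unfold lower; linarith
  · unfold upper; linarith

theorem convexCombo_mem_feasible {S : Shocks Ω} {n : ℕ} {x x' y y' t : ℝ} {ω : Ω}
    (h0 : 0 ≤ t) (h1 : t ≤ 1) (hy : y ∈ S.feasible n x ω) (hy' : y' ∈ S.feasible n x' ω) :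
    (1 - t) * y + t * y' ∈ S.feasible n ((1 - t) * x + t * x') ω := by
  obtain ⟨a1, a2⟩ := hy
  obtain ⟨b1, b2⟩ := hy'
  unfold lower at a1 b1
  unfold upper at a2 b2
  constructor
  · unfold lower
    nlinarith [mul_le_mul_of_nonneg_left a1 (sub_nonneg.2 h1), mul_le_mul_of_nonneg_left b1 h0]
  · unfold upper
    nlinarith [mul_le_mul_of_nonneg_left a2 (sub_nonneg.2 h1), mul_le_mul_of_nonneg_left b2 h0]

theorem lower_le_upper {S : Shocks Ω} {n : ℕ} {ω : Ω} (h : S.U n ω ≤ S.V n ω) (x : ℝ) :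
    S.lower n x ω ≤ S.upper n x ω := by
  unfold lower upper; linarith

end Shocks

variable {μ : Measure Ω} {𝓕 : Filtration ℕ mΩ} {S : Shocks Ω} {p : ℝ}

namespace TransitionDynamics

theorem measurable_vec (hS : TransitionDynamics μ 𝓕 S) (n : ℕ) : Measurable (S.vec n) :=
  (hS.adapted n).mono (𝓕.le _) le_rfl

theorem measurable_A (hS : TransitionDynamics μ 𝓕 S) (n : ℕ) : Measurable (S.A n) :=
  measurable_fst.comp (hS.measurable_vec n)

theorem measurable_B (hS : TransitionDynamics μ 𝓕 S) (n : ℕ) : Measurable (S.B n) :=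
  measurable_fst.comp (measurable_snd.comp (hS.measurable_vec n))

theorem measurable_U (hS : TransitionDynamics μ 𝓕 S) (n : ℕ) : Measurable (S.U n) :=
  measurable_fst.comp (measurable_snd.comp (measurable_snd.comp (hS.measurable_vec n)))

theorem measurable_V (hS : TransitionDynamics μ 𝓕 S) (n : ℕ) : Measurable (S.V n) :=
  measurable_snd.comp (measurable_snd.comp (measurable_snd.comp (hS.measurable_vec n)))

theorem identDistrib_A (hS : TransitionDynamics μ 𝓕 S) (n : ℕ) :
    IdentDistrib (S.A n) (S.A 0) μ μ :=
  (hS.identDistrib n).comp measurable_fst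

theorem identDistrib_drift (hS : TransitionDynamics μ 𝓕 S) (n : ℕ) :
    IdentDistrib (S.drift n) (S.drift 0) μ μ := by
  have : Measurable fun v : ℝ × ℝ × ℝ × ℝ => |v.2.1| + |v.2.2.1| + |v.2.2.2| := by
    simp only [← Real.norm_eq_abs]
    fun_prop
  exact (hS.identDistrib n).comp this

theorem memLp_A (hS : TransitionDynamics μ 𝓕 S) (hp : LpStable μ S p) (n : ℕ) :
    MemLp (S.A n) (ENNReal.ofReal p) μ := by
  refine (hS.identDistrib_A n).symm.memLp_snd ?_
  have h2 := hp.two_le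
  refine (integrable_norm_rpow_iff (hS.measurable_A 0).aestronglyMeasurable
    (by simp; linarith) (by simp)).1 ?_
  simpa [ENNReal.toReal_ofReal (by linarith : 0 ≤ p)] using hp.integrable_A

theorem memLp_drift (hS : TransitionDynamics μ 𝓕 S) (hp : LpStable μ S p) (n : ℕ) :
    MemLp (S.drift n) (ENNReal.ofReal p) μ := by
  refine (hS.identDistrib_drift n).symm.memLp_snd ?_
  have h2 := hp.two_le
  have aux : ∀ X : Ω → ℝ, Measurable X → Integrable (fun ω => |X ω| ^ p) μ →
      MemLp (fun ω => |X ω|) (ENNReal.ofReal p) μ := by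
    intro X hX hi
    refine MemLp.norm ((integrable_norm_rpow_iff hX.aestronglyMeasurable
      (by simp; linarith) (by simp)).1 ?_)
    simpa [ENNReal.toReal_ofReal (by linarith : 0 ≤ p)] using hi
  exact ((aux _ (hS.measurable_B 0) hp.integrable_B).add
    (aux _ (hS.measurable_U 0) hp.integrable_U)).add (aux _ (hS.measurable_V 0) hp.integrable_V)

theorem memLp_abs_A (hS : TransitionDynamics μ 𝓕 S) (hp : LpStable μ S p) (n : ℕ) :
    MemLp (fun ω => |S.A n ω|) (ENNReal.ofReal p) μ :=
  (hS.memLp_A hp n).norm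

theorem lpNorm_A_lt_one (hS : TransitionDynamics μ 𝓕 S) (hp : LpStable μ S p) :
    lpNorm (S.A 0) (ENNReal.ofReal p) μ < 1 := by
  have h2 := hp.two_le
  have h := lpNorm_rpow_eq (by linarith : 0 < p) (hS.measurable_A 0).aestronglyMeasurable (μ := μ)
  by_contra! hge
  have := Real.one_le_rpow hge (by linarith : 0 ≤ p)
  have := hp.integral_A_lt
  linarith

variable [IsProbabilityMeasure μ]

theorem integral_abs_A_lt_one (hS : TransitionDynamics μ 𝓕 S) (hp : LpStable μ S p) :
    Integrable (fun ω => |S.A 0 ω|) μ ∧ ∫ ω, |S.A 0 ω| ∂μ < 1 := by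
  have h2 := hp.two_le
  have hi : Integrable (fun ω => |S.A 0 ω|) μ :=
    (hS.memLp_abs_A hp 0).integrable (by simp; linarith)
  refine ⟨hi, ?_⟩
  -- Bernoulli: `1 + p (|A| - 1) ≤ |A| ^ p`
  have hB : ∀ ω, 1 + p * (|S.A 0 ω| - 1) ≤ |S.A 0 ω| ^ p := fun ω => by
    have := one_add_mul_self_le_rpow_one_add (s := |S.A 0 ω| - 1)
      (by linarith [abs_nonneg (S.A 0 ω)]) (by linarith : 1 ≤ p)
    simpa using this
  have hi2 : Integrable (fun ω => p * (|S.A 0 ω| - 1)) μ :=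
    (hi.sub (integrable_const 1)).const_mul p
  have hle : ∫ ω, (1 + p * (|S.A 0 ω| - 1)) ∂μ ≤ ∫ ω, |S.A 0 ω| ^ p ∂μ :=
    integral_mono ((integrable_const (1 : ℝ)).add hi2) hp.integrable_A hB
  have e : ∫ ω, (1 + p * (|S.A 0 ω| - 1)) ∂μ = 1 + p * (∫ ω, |S.A 0 ω| ∂μ - 1) := by
    rw [integral_add (integrable_const _) hi2, integral_const_mul,
      integral_sub hi (integrable_const 1)]
    simp
  have hlt := hp.integral_A_lt
  rw [e] at hle
  nlinarith

theorem integrable_drift (hS : TransitionDynamics μ 𝓕 S) (hp : LpStable μ S p) :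
    Integrable (S.drift 0) μ := by
  have h2 := hp.two_le
  exact (hS.memLp_drift hp 0).integrable (by simp; linarith)

/-- With positive probability the map `x ↦ A x` is contracting from above. -/
theorem not_ae_one_le_A (hp : LpStable μ S p) : ¬ ∀ᵐ ω ∂μ, 1 ≤ S.A 0 ω := by
  intro h
  have h2 := hp.two_le
  have : ∫ _, (1 : ℝ) ∂μ ≤ ∫ ω, |S.A 0 ω| ^ p ∂μ := by
    refine integral_mono_ae (integrable_const _) hp.integrable_A ?_
    filter_upwards [h] with ω hω
    exact Real.one_le_rpow (hω.trans (le_abs_self _)) (by linarith)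
  have hlt := hp.integral_A_lt
  simp at this
  linarith

/-- Minkowski's bound for the norm of an affine combination of `|A|` and the drift. -/
theorem lpNorm_affine_le (hS : TransitionDynamics μ 𝓕 S) (hp : LpStable μ S p)
    {k s r : ℝ} (hk : 0 ≤ k) (hs : 0 ≤ s) (hr : 0 ≤ r) :
    MemLp (fun ω => k + |S.A 0 ω| * s + r * S.drift 0 ω) (ENNReal.ofReal p) μ ∧
      lpNorm (fun ω => k + |S.A 0 ω| * s + r * S.drift 0 ω) (ENNReal.ofReal p) μ ≤
        k + lpNorm (S.A 0) (ENNReal.ofReal p) μ * s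
          + r * lpNorm (S.drift 0) (ENNReal.ofReal p) μ := by
  have h2 := hp.two_le
  have h1 : 1 ≤ ENNReal.ofReal p := by simp; linarith
  have m1 : MemLp (fun _ : Ω => k) (ENNReal.ofReal p) μ := memLp_const k
  have m2 : MemLp (fun ω => |S.A 0 ω| * s) (ENNReal.ofReal p) μ := by
    simpa [mul_comm] using (hS.memLp_abs_A hp 0).const_mul s
  have m3 : MemLp (fun ω => r * S.drift 0 ω) (ENNReal.ofReal p) μ :=
    (hS.memLp_drift hp 0).const_mul r
  refine ⟨(m1.add m2).add m3, ?_⟩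
  have e1 := lpNorm_add_le (f := (fun _ : Ω => k) + fun ω => |S.A 0 ω| * s)
    (g := fun ω => r * S.drift 0 ω) (m1.add m2) h1
  have e2 := lpNorm_add_le (f := fun _ : Ω => k) (g := fun ω => |S.A 0 ω| * s) m1 h1
  have n1 : lpNorm (fun _ : Ω => k) (ENNReal.ofReal p) μ = k := by
    rw [lpNorm_const (by simp; linarith) (IsProbabilityMeasure.ne_zero μ)]
    simp [abs_of_nonneg hk]
  have n2 : lpNorm (fun ω => |S.A 0 ω| * s) (ENNReal.ofReal p) μ =
      lpNorm (S.A 0) (ENNReal.ofReal p) μ * s := by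
    have : (fun ω => |S.A 0 ω| * s) = s • fun ω => |S.A 0 ω| := by
      funext ω; simp [mul_comm]
    rw [this, lpNorm_const_smul, lpNorm_fun_abs (hS.measurable_A 0).aestronglyMeasurable]
    simp [abs_of_nonneg hs, mul_comm]
  have n3 : lpNorm (fun ω => r * S.drift 0 ω) (ENNReal.ofReal p) μ =
      r * lpNorm (S.drift 0) (ENNReal.ofReal p) μ := by
    have : (fun ω => r * S.drift 0 ω) = r • S.drift 0 := by
      funext ω; simp
    rw [this, lpNorm_const_smul]
    simp [abs_of_nonneg hr]
  rw [n1, n2] at e2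
  rw [n3] at e1
  refine le_trans (le_of_eq ?_) (e1.trans (by linarith))
  rfl

/-- The weight `(k + s) ^ (p - 1)` is contracted by multiplication with `|A|`, for large `k`. -/
theorem exists_weight_contraction (hS : TransitionDynamics μ 𝓕 S) (hp : LpStable μ S p) :
    ∃ k θ : ℝ, 1 ≤ k ∧ 0 ≤ θ ∧ θ < 1 ∧ ∀ s, 0 ≤ s →
      Integrable (fun ω => |S.A 0 ω| * (k + |S.A 0 ω| * s + 2 * S.drift 0 ω) ^ (p - 1)) μ ∧
      ∫ ω, |S.A 0 ω| * (k + |S.A 0 ω| * s + 2 * S.drift 0 ω) ^ (p - 1) ∂μ ≤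
        θ * (k + s) ^ (p - 1) := by
  have h2 := hp.two_le
  have hα := hS.lpNorm_A_lt_one hp
  set α := lpNorm (S.A 0) (ENNReal.ofReal p) μ with hαdef
  set ρ := lpNorm (S.drift 0) (ENNReal.ofReal p) μ with hρdef
  have hα0 : 0 ≤ α := lpNorm_nonneg
  have hρ0 : 0 ≤ ρ := lpNorm_nonneg
  have hlim : Tendsto (fun k : ℝ => α * (1 + 2 * ρ / k) ^ (p - 1)) atTop
      (𝓝 (α * (1 + 0) ^ (p - 1))) := by
    refine Tendsto.const_mul α (Tendsto.rpow_const ?_ (Or.inr (by linarith)))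
    exact tendsto_const_nhds.add (tendsto_const_nhds.div_atTop tendsto_id)
  rw [add_zero, Real.one_rpow, mul_one] at hlim
  -- by Hölder and Minkowski the expectation is at most `α (k + 2 ρ + α s) ^ (p - 1)`
  obtain ⟨k, hk1, hk2⟩ := ((hlim.eventually (gt_mem_nhds (by linarith : α < (1 + α) / 2))).and
    (eventually_ge_atTop 1)).exists
  refine ⟨k, (1 + α) / 2, hk2, by linarith, by linarith, fun s hs => ?_⟩
  have hk0 : 0 < k := by linarith
  obtain ⟨m, hle⟩ := hS.lpNorm_affine_le hp hk0.le hs zero_le_two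
  obtain ⟨i1, i2⟩ := integral_mul_rpow_le (by linarith : 1 < p) (hS.memLp_abs_A hp 0) m
    (fun ω => abs_nonneg _) (fun ω => by
      have := S.drift_nonneg 0 ω
      positivity)
  refine ⟨i1, i2.trans ?_⟩
  rw [lpNorm_fun_abs (hS.measurable_A 0).aestronglyMeasurable]
  calc α * lpNorm (fun ω => k + |S.A 0 ω| * s + 2 * S.drift 0 ω) (ENNReal.ofReal p) μ ^ (p - 1)
      ≤ α * ((1 + 2 * ρ / k) * (k + s)) ^ (p - 1) := by
        refine mul_le_mul_of_nonneg_left (Real.rpow_le_rpow lpNorm_nonneg (hle.trans ?_)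
          (by linarith)) hα0
        have : (1 + 2 * ρ / k) * (k + s) = k + s + 2 * ρ + 2 * ρ / k * s := by
          field_simp; ring
        rw [this]
        have : 0 ≤ 2 * ρ / k * s := by positivity
        nlinarith
    _ = α * (1 + 2 * ρ / k) ^ (p - 1) * (k + s) ^ (p - 1) := by
        rw [Real.mul_rpow (by positivity) (by positivity), mul_assoc]
    _ ≤ (1 + α) / 2 * (k + s) ^ (p - 1) :=
        mul_le_mul_of_nonneg_right hk1.le (Real.rpow_nonneg (by linarith) _)

/-- The bound that controls the increments of the one-period cost. -/
theorem exists_increment_bound (hS : TransitionDynamics μ 𝓕 S) (hp : LpStable μ S p) :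
    ∃ L > 0, ∀ k s : ℝ, 1 ≤ k → 0 ≤ s →
      Integrable (fun ω => (1 + |S.A 0 ω|) *
        (1 + 2 * s + |S.A 0 ω| * (2 * s) + 1 * S.drift 0 ω) ^ (p - 1)) μ ∧
      ∫ ω, (1 + |S.A 0 ω|) *
        (1 + 2 * s + |S.A 0 ω| * (2 * s) + 1 * S.drift 0 ω) ^ (p - 1) ∂μ ≤
        L * (k + s) ^ (p - 1) := by
  have h2 := hp.two_le
  have hα := hS.lpNorm_A_lt_one hp
  set α := lpNorm (S.A 0) (ENNReal.ofReal p) μ with hαdef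
  set ρ := lpNorm (S.drift 0) (ENNReal.ofReal p) μ with hρdef
  have hα0 : 0 ≤ α := lpNorm_nonneg
  have hρ0 : 0 ≤ ρ := lpNorm_nonneg
  refine ⟨2 * (4 + ρ) ^ (p - 1), by positivity, fun k s hk hs => ?_⟩
  obtain ⟨m, hle⟩ := hS.lpNorm_affine_le hp (by linarith : 0 ≤ 1 + 2 * s)
    (by linarith : 0 ≤ 2 * s) zero_le_one
  obtain ⟨m1, hle1⟩ := hS.lpNorm_affine_le hp zero_le_one zero_le_one le_rfl
  simp only [mul_one, zero_mul, add_zero] at m1 hle1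
  obtain ⟨i1, i2⟩ := integral_mul_rpow_le (by linarith : 1 < p) m1 m
    (fun ω => by positivity) (fun ω => by
      have := S.drift_nonneg 0 ω
      positivity)
  refine ⟨i1, i2.trans ?_⟩
  have hb : lpNorm (fun ω => 1 + 2 * s + |S.A 0 ω| * (2 * s) + 1 * S.drift 0 ω)
      (ENNReal.ofReal p) μ ≤ (4 + ρ) * (k + s) := by
    refine hle.trans ?_
    nlinarith [mul_nonneg hρ0 hs, mul_nonneg hα0 hs]
  calc _ ≤ 2 * ((4 + ρ) * (k + s)) ^ (p - 1) := by
        refine mul_le_mul (by linarith) (Real.rpow_le_rpow lpNorm_nonneg hb (by linarith))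
          (Real.rpow_nonneg lpNorm_nonneg _) (by norm_num)
    _ = 2 * (4 + ρ) ^ (p - 1) * (k + s) ^ (p - 1) := by
        rw [Real.mul_rpow (by positivity) (by linarith), mul_assoc]

end TransitionDynamics

/-! ### The one-period minimization -/

/-- The adjustment cost `f (y - x)` that depends on the increment only. -/
abbrev incr (f : ℝ → ℝ) : ℝ → ℝ → ℝ := fun x y => f (y - x)

section StepValue

variable {f h : ℝ → ℝ} {x : ℝ} {ω : Ω}

theorem bddBelow_image_feasible (hf : Continuous f) (hh : Continuous h) :
    BddBelow ((fun y => incr f x y + h y) '' S.feasible 0 x ω) :=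
  (isCompact_Icc.image (by unfold incr; fun_prop)).bddBelow

theorem stepValue_le (hf : Continuous f) (hh : Continuous h) {y : ℝ}
    (hy : y ∈ S.feasible 0 x ω) : stepValue S (incr f) h x ω ≤ f (y - x) + h y :=
  csInf_le (bddBelow_image_feasible hf hh) ⟨y, hy, rfl⟩

theorem le_stepValue (hω : S.U 0 ω ≤ S.V 0 ω) {m : ℝ}
    (hm : ∀ y ∈ S.feasible 0 x ω, m ≤ f (y - x) + h y) : m ≤ stepValue S (incr f) h x ω := by
  refine le_csInf ((nonempty_Icc.2 (Shocks.lower_le_upper hω x)).image _) ?_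
  rintro _ ⟨y, hy, rfl⟩
  exact hm y hy

theorem exists_stepValue_eq (hf : Continuous f) (hh : Continuous h) (hω : S.U 0 ω ≤ S.V 0 ω) :
    ∃ y ∈ S.feasible 0 x ω, stepValue S (incr f) h x ω = f (y - x) + h y := by
  have hc : Continuous fun y => incr f x y + h y := by unfold incr; fun_prop
  obtain ⟨y, hy, he⟩ := (isCompact_Icc.image hc).sInf_mem
    ((nonempty_Icc.2 (Shocks.lower_le_upper hω x)).image _)
  exact ⟨y, hy, he.symm⟩

/-- For `U ≤ V` the minimum over the feasible interval is a minimum over `[0, 1]` whose objective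
depends continuously on the coefficients, so it is measurable. -/
theorem aestronglyMeasurable_stepValue (hS : TransitionDynamics μ 𝓕 S) (hf : Continuous f)
    (hh : Continuous h) (x : ℝ) : AEStronglyMeasurable (stepValue S (incr f) h x) μ := by
  set φ : ℝ × ℝ → ℝ := fun q =>
    sInf ((fun s : ℝ => f ((1 - s) * q.1 + s * q.2 - x) + h ((1 - s) * q.1 + s * q.2)) '' Icc 0 1)
    with hφ
  have hφc : Continuous φ := by
    refine isCompact_Icc.continuous_sInf
      (f := fun (q : ℝ × ℝ) (s : ℝ) =>
        f ((1 - s) * q.1 + s * q.2 - x) + h ((1 - s) * q.1 + s * q.2)) ?_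
    fun_prop
  have hl : Measurable (S.lower 0 x) :=
    (((hS.measurable_A 0).mul_const x).add (hS.measurable_B 0)).add (hS.measurable_U 0)
  have hu : Measurable (S.upper 0 x) :=
    (((hS.measurable_A 0).mul_const x).add (hS.measurable_B 0)).add (hS.measurable_V 0)
  refine ⟨fun ω => φ (S.lower 0 x ω, S.upper 0 x ω),
    (hφc.measurable.comp (hl.prodMk hu)).stronglyMeasurable, ?_⟩
  filter_upwards [hS.interval 0] with ω hω
  have hlu := Shocks.lower_le_upper hω x
  rw [stepValue, hφ, Shocks.feasible, ← segment_eq_Icc hlu, segment_eq_image]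
  rw [image_image]
  simp only [smul_eq_mul]

theorem integrable_envelope [IsProbabilityMeasure μ] (hS : TransitionDynamics μ 𝓕 S)
    (hp : LpStable μ S p) (x : ℝ) :
    Integrable (fun ω => (1 + |x| + |S.A 0 ω| * |x| + 1 * S.drift 0 ω) ^ p) μ := by
  have h2 := hp.two_le
  obtain ⟨m, -⟩ := hS.lpNorm_affine_le hp (by positivity : 0 ≤ 1 + |x|) (abs_nonneg x) zero_le_one
  refine (integrable_rpow_of_memLp (by linarith) m).congr (ae_of_all _ fun ω => ?_)
  have := S.drift_nonneg 0 ω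
  simp only
  rw [abs_of_nonneg (by positivity)]

theorem abs_stepValue_le (hp : 0 ≤ p) (hf : Continuous f) (hh : Continuous h)
    (hω : S.U 0 ω ≤ S.V 0 ω) {K C : ℝ} (hK : ∀ z, |f z| ≤ K * (1 + |z|) ^ p)
    (hC : ∀ z, |h z| ≤ C * (1 + |z|) ^ p) :
    |stepValue S (incr f) h x ω| ≤
      (K + C) * (1 + |x| + |S.A 0 ω| * |x| + 1 * S.drift 0 ω) ^ p := by
  obtain ⟨y, hy, he⟩ := exists_stepValue_eq (x := x) hf hh hω
  have hya := Shocks.abs_le_of_mem_feasible hy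
  have hd := S.drift_nonneg 0 ω
  have hK0 : 0 ≤ K := by simpa using (abs_nonneg (f 0)).trans (hK 0)
  have hC0 : 0 ≤ C := by simpa using (abs_nonneg (h 0)).trans (hC 0)
  have hx := abs_nonneg x
  rw [he, add_mul]
  refine (abs_add_le _ _).trans (add_le_add ?_ ?_)
  · refine (hK _).trans (mul_le_mul_of_nonneg_left (Real.rpow_le_rpow (by positivity) ?_ hp) hK0)
    have := abs_sub y x
    linarith
  · refine (hC _).trans (mul_le_mul_of_nonneg_left (Real.rpow_le_rpow (by positivity) ?_ hp) hC0)
    linarith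

end StepValue

/-- Polynomial growth of order `p`. -/
def HasGrowth (p : ℝ) (h : ℝ → ℝ) : Prop := ∃ C, ∀ z, |h z| ≤ C * (1 + |z|) ^ p

theorem HasGrowth.of_le {h : ℝ → ℝ} (hp : 0 ≤ p) (hh : ∃ C, ∀ x, |h x| ≤ C * (1 + |x| ^ p)) :
    HasGrowth p h := by
  obtain ⟨C, hC⟩ := hh
  refine ⟨|C| * 2, fun z => (hC z).trans ?_⟩
  have h1 : |z| ^ p ≤ (1 + |z|) ^ p :=
    Real.rpow_le_rpow (abs_nonneg z) (by linarith [abs_nonneg z]) hp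
  have h2 : 1 ≤ (1 + |z|) ^ p :=
    Real.one_le_rpow (by linarith [abs_nonneg z]) hp
  have h3 : 0 ≤ |z| ^ p := by positivity
  calc C * (1 + |z| ^ p) ≤ |C| * (1 + |z| ^ p) := by gcongr; exact le_abs_self C
    _ ≤ |C| * (2 * (1 + |z|) ^ p) := by gcongr; linarith
    _ = |C| * 2 * (1 + |z|) ^ p := by ring

theorem IncrementCost.hasGrowth {f : ℝ → ℝ} (hf : IncrementCost p f) : HasGrowth p f := by
  obtain ⟨K, -, hK⟩ := hf.growth
  exact ⟨K, fun z => by rw [abs_of_nonneg (hf.nonneg z)]; exact hK z⟩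

section Bellman

variable {f h h₁ h₂ : ℝ → ℝ}

/-- The expected value of the one-period minimization, as a function of the previous action. -/
noncomputable def bellman (μ : Measure Ω) (S : Shocks Ω) (f h : ℝ → ℝ) (x : ℝ) : ℝ :=
  ∫ ω, stepValue S (incr f) h x ω ∂μ

theorem stepValue_add_const {ω : Ω} (hω : S.U 0 ω ≤ S.V 0 ω) (hf : Continuous f)
    (hh : Continuous h) (x a : ℝ) :
    stepValue S (incr f) (fun y => h y + a) x ω = stepValue S (incr f) h x ω + a := by
  have hh' : Continuous fun y => h y + a := hh.add continuous_const
  apply le_antisymm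
  · obtain ⟨y, hy, he⟩ := exists_stepValue_eq (x := x) hf hh hω
    have := stepValue_le hf hh' hy
    linarith
  · obtain ⟨y, hy, he⟩ := exists_stepValue_eq (x := x) hf hh' hω
    have := stepValue_le hf hh hy
    linarith

theorem stepValue_mono {ω : Ω} (hω : S.U 0 ω ≤ S.V 0 ω) (hf : Continuous f)
    (hh₁ : Continuous h₁) (hle : ∀ y, h₁ y ≤ h₂ y) (x : ℝ) :
    stepValue S (incr f) h₁ x ω ≤ stepValue S (incr f) h₂ x ω :=
  le_stepValue hω fun y hy => (stepValue_le hf hh₁ hy).trans (by linarith [hle y])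

theorem stepValue_convexCombo {ω : Ω} (hω : S.U 0 ω ≤ S.V 0 ω) (hf : ConvexOn ℝ univ f)
    (hh : ConvexOn ℝ univ h) (x x' : ℝ) {t : ℝ} (h0 : 0 ≤ t) (h1 : t ≤ 1) :
    stepValue S (incr f) h ((1 - t) * x + t * x') ω ≤
      (1 - t) * stepValue S (incr f) h x ω + t * stepValue S (incr f) h x' ω := by
  have hfc := continuous_of_convexOn_univ hf
  have hhc := continuous_of_convexOn_univ hh
  obtain ⟨y, hy, he⟩ := exists_stepValue_eq (x := x) hfc hhc hω
  obtain ⟨y', hy', he'⟩ := exists_stepValue_eq (x := x') hfc hhc hω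
  refine (stepValue_le hfc hhc (Shocks.convexCombo_mem_feasible h0 h1 hy hy')).trans ?_
  have e1 := convexOn_univ_le hf (y - x) (y' - x') h0 h1
  have e2 := convexOn_univ_le hh y y' h0 h1
  have e3 : (1 - t) * y + t * y' - ((1 - t) * x + t * x') =
      (1 - t) * (y - x) + t * (y' - x') := by ring
  rw [e3, he, he']
  linarith

theorem convexOn_stepValue {ω : Ω} (hω : S.U 0 ω ≤ S.V 0 ω) (hf : ConvexOn ℝ univ f)
    (hh : ConvexOn ℝ univ h) : ConvexOn ℝ univ fun x => stepValue S (incr f) h x ω := by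
  refine ⟨convex_univ, fun x _ x' _ a b ha hb hab => ?_⟩
  obtain rfl : a = 1 - b := by linarith
  exact stepValue_convexCombo hω hf hh x x' hb (by linarith)

variable [IsProbabilityMeasure μ]

theorem integrable_stepValue (hS : TransitionDynamics μ 𝓕 S) (hp : LpStable μ S p)
    (hf : IncrementCost p f) (hh : Continuous h) (hg : HasGrowth p h) (x : ℝ) :
    Integrable (stepValue S (incr f) h x) μ := by
  have h2 := hp.two_le
  obtain ⟨K, hK⟩ := hf.hasGrowth
  obtain ⟨C, hC⟩ := hg
  refine ((integrable_envelope hS hp x).const_mul (K + C)).mono'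
    (aestronglyMeasurable_stepValue hS hf.continuous hh x) ?_
  filter_upwards [hS.interval 0] with ω hω
  exact abs_stepValue_le (by linarith) hf.continuous hh hω hK hC

theorem convexOn_bellman (hS : TransitionDynamics μ 𝓕 S) (hp : LpStable μ S p)
    (hf : IncrementCost p f) (hh : ConvexOn ℝ univ h) (hg : HasGrowth p h) :
    ConvexOn ℝ univ (bellman μ S f h) := by
  have hi := integrable_stepValue hS hp hf (continuous_of_convexOn_univ hh) hg
  refine ⟨convex_univ, fun x _ x' _ a b ha hb hab => ?_⟩
  simp only [smul_eq_mul, bellman]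
  rw [← integral_const_mul, ← integral_const_mul,
    ← integral_add ((hi x).const_mul a) ((hi x').const_mul b)]
  refine integral_mono_ae (hi _) (((hi x).const_mul a).add ((hi x').const_mul b)) ?_
  filter_upwards [hS.interval 0] with ω hω
  exact (convexOn_stepValue hω hf.convex hh).2 (mem_univ x) (mem_univ x') ha hb hab

end Bellman

/-! ### A class of value functions that is invariant under the Bellman operator -/

/-- Convex functions whose increments are bounded by `K |x - x'| (k + |x| + |x'|) ^ (p - 1)`. -/
structure TameValue (p K k : ℝ) (h : ℝ → ℝ) : Prop where
  convex : ConvexOn ℝ univ h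
  sub_le : ∀ x x', h x - h x' ≤ K * |x - x'| * (k + |x| + |x'|) ^ (p - 1)

namespace TameValue

variable {K k : ℝ} {h : ℝ → ℝ}

theorem continuous (hh : TameValue p K k h) : Continuous h := continuous_of_convexOn_univ hh.convex

theorem abs_sub_le (hh : TameValue p K k h) (x x' : ℝ) :
    |h x - h x'| ≤ K * |x - x'| * (k + |x| + |x'|) ^ (p - 1) := by
  refine abs_le.2 ⟨?_, hh.sub_le x x'⟩
  have := hh.sub_le x' x
  rw [abs_sub_comm, add_right_comm] at this
  linarith

theorem growth_le (hh : TameValue p K k h) (hp : 1 ≤ p) (hK : 0 ≤ K) (hk : 1 ≤ k) (z : ℝ) :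
    |h z| ≤ (|h 0| + K * k ^ p) * (1 + |z|) ^ p := by
  have h1 := hh.abs_sub_le z 0
  rw [sub_zero, abs_zero, add_zero] at h1
  have hz := abs_nonneg z
  have h2 : |z| * (k + |z|) ^ (p - 1) ≤ k ^ p * (1 + |z|) ^ p := by
    rw [← Real.mul_rpow (by linarith) (by linarith)]
    have hb : k + |z| ≤ k * (1 + |z|) := by nlinarith
    calc |z| * (k + |z|) ^ (p - 1) ≤ k * (1 + |z|) * (k * (1 + |z|)) ^ (p - 1) := by
          refine mul_le_mul (by linarith) (Real.rpow_le_rpow (by linarith) hb (by linarith))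
            (Real.rpow_nonneg (by linarith) _) (by positivity)
      _ = (k * (1 + |z|)) ^ p := by
          rw [mul_comm, ← Real.rpow_add_one (by positivity)]; ring_nf
  have h3 : 1 ≤ (1 + |z|) ^ p := Real.one_le_rpow (by linarith) (by linarith)
  have h4 : |h z| ≤ |h 0| + |h z - h 0| := by
    have := abs_add_le (h 0) (h z - h 0)
    simpa using this
  have h5 : |h 0| ≤ |h 0| * (1 + |z|) ^ p := le_mul_of_one_le_right (abs_nonneg _) h3
  have h6 := mul_le_mul_of_nonneg_left h2 hK
  rw [add_mul]
  linarith

theorem hasGrowth (hh : TameValue p K k h) (hp : 1 ≤ p) (hK : 0 ≤ K) (hk : 1 ≤ k) :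
    HasGrowth p h := ⟨_, hh.growth_le hp hK hk⟩

theorem smul (hh : TameValue p K k h) (hK : 0 ≤ K) (hk : 0 ≤ k) {b : ℝ} (h0 : 0 ≤ b)
    (h1 : b ≤ 1) : TameValue p K k fun x => b * h x where
  convex := hh.convex.smul h0
  sub_le x x' := by
    rw [← mul_sub]
    have := hh.sub_le x x'
    have h3 : 0 ≤ K * |x - x'| * (k + |x| + |x'|) ^ (p - 1) := by positivity
    nlinarith

theorem add_const (hh : TameValue p K k h) (a : ℝ) : TameValue p K k fun x => h x + a where
  convex := hh.convex.add_const a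
  sub_le x x' := by simpa using hh.sub_le x x'

theorem zero (hK : 0 ≤ K) (hk : 0 ≤ k) : TameValue p K k fun _ => 0 where
  convex := convexOn_const 0 convex_univ
  sub_le x x' := by rw [sub_zero]; positivity

theorem of_tendsto {H : ℕ → ℝ → ℝ} (hH : ∀ n, TameValue p K k (H n))
    (hlim : ∀ x, Tendsto (fun n => H n x) atTop (𝓝 (h x))) : TameValue p K k h where
  convex := by
    refine ⟨convex_univ, fun x _ y _ a b ha hb hab => ?_⟩
    exact le_of_tendsto_of_tendsto' (hlim _) (((hlim x).const_mul a).add ((hlim y).const_mul b))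
      fun n => (hH n).convex.2 (mem_univ x) (mem_univ y) ha hb hab
  sub_le x x' := le_of_tendsto ((hlim x).sub (hlim x'))
    (Eventually.of_forall fun n => (hH n).sub_le x x')

/-- Pointwise limits of tame functions are locally uniform, by equicontinuity. -/
theorem tendstoLocallyUniformly {H : ℕ → ℝ → ℝ} (hp : 1 ≤ p)
    (hH : ∀ n, TameValue p K k (H n)) (hlim : ∀ x, Tendsto (fun n => H n x) atTop (𝓝 (h x))) :
    TendstoLocallyUniformly H h atTop := by
  have hh : TameValue p K k h := of_tendsto hH hlim
  rw [Metric.tendstoLocallyUniformly_iff]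
  intro ε hε y
  have hcont : Tendsto (fun z : ℝ => K * |z - y| * (k + |z| + |y|) ^ (p - 1)) (𝓝 y) (𝓝 0) := by
    have : Continuous fun z : ℝ => K * |z - y| * (k + |z| + |y|) ^ (p - 1) := by
      refine Continuous.mul (by fun_prop) (Continuous.rpow_const (by fun_prop) fun z => ?_)
      right; linarith
    simpa using this.tendsto y
  refine ⟨{z | K * |z - y| * (k + |z| + |y|) ^ (p - 1) < ε / 3},
    hcont.eventually (gt_mem_nhds (by positivity)), ?_⟩
  filter_upwards [(Metric.tendsto_nhds.1 (hlim y)) (ε / 3) (by positivity)] with n hn z hz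
  rw [Real.dist_eq] at hn ⊢
  have e1 := hh.abs_sub_le z y
  have e2 := (hH n).abs_sub_le z y
  have hz' : K * |z - y| * (k + |z| + |y|) ^ (p - 1) < ε / 3 := hz
  rw [abs_lt] at hn ⊢
  rw [abs_le] at e1 e2
  constructor <;> linarith

end TameValue

section BellmanTame

variable {f h : ℝ → ℝ} {K k : ℝ}

theorem tendsto_stepValue {H : ℕ → ℝ → ℝ} (hp : 1 ≤ p) (hf : IncrementCost p f)
    (hH : ∀ n, TameValue p K k (H n))
    (hlim : ∀ x, Tendsto (fun n => H n x) atTop (𝓝 (h x))) (x : ℝ) {ω : Ω}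
    (hω : S.U 0 ω ≤ S.V 0 ω) :
    Tendsto (fun n => stepValue S (incr f) (H n) x ω) atTop
      (𝓝 (stepValue S (incr f) h x ω)) := by
  have hh : TameValue p K k h := TameValue.of_tendsto hH hlim
  have hu := ((tendstoLocallyUniformlyOn_iff_tendstoUniformlyOn_of_compact
    (isCompact_Icc (a := S.lower 0 x ω) (b := S.upper 0 x ω))).1
    (TameValue.tendstoLocallyUniformly hp hH hlim).tendstoLocallyUniformlyOn)
  rw [Metric.tendstoUniformlyOn_iff] at hu
  rw [Metric.tendsto_nhds]
  intro ε hε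
  filter_upwards [hu (ε / 2) (by positivity)] with n hn
  have hn' : ∀ y ∈ S.feasible 0 x ω, |h y - H n y| < ε / 2 := hn
  obtain ⟨y, hy, he⟩ := exists_stepValue_eq (x := x) hf.continuous hh.continuous hω
  obtain ⟨y', hy', he'⟩ := exists_stepValue_eq (x := x) hf.continuous (hH n).continuous hω
  have e1 := stepValue_le hf.continuous hh.continuous hy'
  have e2 := stepValue_le hf.continuous (hH n).continuous hy
  have b1 := abs_lt.1 (hn' y hy)
  have b2 := abs_lt.1 (hn' y' hy')
  rw [Real.dist_eq, abs_lt]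
  constructor <;> linarith

variable [IsProbabilityMeasure μ]

/-- A bound of the Bellman operator at `x` that is uniform over tame functions with `|h 0| ≤ a`. -/
theorem exists_abs_stepValue_le (hS : TransitionDynamics μ 𝓕 S) (hp : LpStable μ S p)
    (hf : IncrementCost p f) (hK : 0 ≤ K) (hk : 1 ≤ k) (a x : ℝ) :
    ∃ b : Ω → ℝ, Integrable b μ ∧ ∀ h, TameValue p K k h → |h 0| ≤ a →
      ∀ᵐ ω ∂μ, |stepValue S (incr f) h x ω| ≤ b ω := by
  have h2 := hp.two_le
  obtain ⟨L, hL⟩ := hf.hasGrowth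
  refine ⟨_, (integrable_envelope hS hp x).const_mul (L + (a + K * k ^ p)), fun h hh h0 => ?_⟩
  filter_upwards [hS.interval 0] with ω hω
  refine abs_stepValue_le (by linarith) hf.continuous hh.continuous hω hL fun z => ?_
  refine (hh.growth_le (by linarith) hK hk z).trans ?_
  gcongr

theorem tendsto_bellman {H : ℕ → ℝ → ℝ} (hS : TransitionDynamics μ 𝓕 S) (hp : LpStable μ S p)
    (hf : IncrementCost p f) (hK : 0 ≤ K) (hk : 1 ≤ k) (hH : ∀ n, TameValue p K k (H n))
    (hlim : ∀ x, Tendsto (fun n => H n x) atTop (𝓝 (h x))) (x : ℝ) :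
    Tendsto (fun n => bellman μ S f (H n) x) atTop (𝓝 (bellman μ S f h x)) := by
  have h2 := hp.two_le
  obtain ⟨a, ha⟩ := (hlim 0).abs.bddAbove_range
  obtain ⟨b, hb, hbound⟩ := exists_abs_stepValue_le hS hp hf hK hk a x
  refine tendsto_integral_of_dominated_convergence b
    (fun n => aestronglyMeasurable_stepValue hS hf.continuous (hH n).continuous x) hb
    (fun n => hbound _ (hH n) (ha ⟨n, rfl⟩)) ?_
  filter_upwards [hS.interval 0] with ω hω
  exact tendsto_stepValue (by linarith) hf hH hlim x hω

/-- The key a priori estimate: an optimal action for `x'`, moved by `A (x - x')`, is feasible for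
`x`. This changes the increment by `(A - 1) (x - x')` and contracts the increment of the value
function, because multiplication with `|A|` contracts the weight. -/
theorem exists_tame_bellman (hS : TransitionDynamics μ 𝓕 S) (hp : LpStable μ S p)
    (hf : IncrementCost p f) :
    ∃ K k : ℝ, 0 ≤ K ∧ 1 ≤ k ∧ ∀ h, TameValue p K k h → TameValue p K k (bellman μ S f h) := by
  have h2 := hp.two_le
  obtain ⟨k, θ, hk, hθ0, hθ1, hcontr⟩ := hS.exists_weight_contraction hp
  obtain ⟨L, hL, hincr⟩ := hS.exists_increment_bound hp
  obtain ⟨C, hC, hfC⟩ := hf.exists_sub_le h2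
  have hθ : 0 < 1 - θ := by linarith
  refine ⟨C * L / (1 - θ), k, by positivity, hk, fun h hh => ?_⟩
  set K := C * L / (1 - θ) with hKdef
  have hK : 0 ≤ K := by positivity
  have hKeq : C * L + K * θ = K := by rw [hKdef]; field_simp; ring
  have hg := hh.hasGrowth (by linarith) hK hk
  have hi := integrable_stepValue hS hp hf hh.continuous hg
  refine ⟨convexOn_bellman hS hp hf hh.convex hg, fun x x' => ?_⟩
  set s := |x| + |x'| with hs
  have hs0 : 0 ≤ s := by positivity
  obtain ⟨i1, b1⟩ := hcontr s hs0
  obtain ⟨i2, b2⟩ := hincr k s hk hs0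
  have hpt : ∀ᵐ ω ∂μ, stepValue S (incr f) h x ω - stepValue S (incr f) h x' ω ≤
      C * |x - x'| * ((1 + |S.A 0 ω|) *
        (1 + 2 * s + |S.A 0 ω| * (2 * s) + 1 * S.drift 0 ω) ^ (p - 1)) +
      K * |x - x'| * (|S.A 0 ω| * (k + |S.A 0 ω| * s + 2 * S.drift 0 ω) ^ (p - 1)) := by
    filter_upwards [hS.interval 0] with ω hω
    obtain ⟨y, hy, he⟩ := exists_stepValue_eq (x := x') hf.continuous hh.continuous hω
    have hy2 := Shocks.add_mem_feasible hy (x - x')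
    rw [add_sub_cancel] at hy2
    have e1 := stepValue_le hf.continuous hh.continuous hy2
    have n1 := Shocks.abs_le_of_mem_feasible hy
    have n2 := Shocks.abs_le_of_mem_feasible hy2
    have hd := S.drift_nonneg 0 ω
    have hA := abs_nonneg (S.A 0 ω)
    have e2 := hfC (y - x') ((S.A 0 ω - 1) * (x - x'))
    rw [show y - x' + (S.A 0 ω - 1) * (x - x') = y + S.A 0 ω * (x - x') - x by ring] at e2
    have e3 := hh.sub_le (y + S.A 0 ω * (x - x')) y
    rw [add_sub_cancel_left, abs_mul] at e3
    have hxx : |x - x'| ≤ s := abs_sub x x'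
    have hA1 : |S.A 0 ω - 1| ≤ 1 + |S.A 0 ω| := by
      have := abs_sub (S.A 0 ω) 1
      rw [abs_one] at this; linarith
    have hx0 := abs_nonneg x
    have hx0' := abs_nonneg x'
    have hxx0 := abs_nonneg (x - x')
    have f1 : C * |(S.A 0 ω - 1) * (x - x')| *
        (1 + |y - x'| + |(S.A 0 ω - 1) * (x - x')|) ^ (p - 1) ≤
        C * |x - x'| * ((1 + |S.A 0 ω|) *
        (1 + 2 * s + |S.A 0 ω| * (2 * s) + 1 * S.drift 0 ω) ^ (p - 1)) := by
      rw [abs_mul]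
      have hm : |S.A 0 ω - 1| * |x - x'| ≤ (1 + |S.A 0 ω|) * s :=
        mul_le_mul hA1 hxx (abs_nonneg _) (by linarith)
      have hbase : 1 + |y - x'| + |S.A 0 ω - 1| * |x - x'| ≤
          1 + 2 * s + |S.A 0 ω| * (2 * s) + 1 * S.drift 0 ω := by
        have := abs_sub y x'
        have : |S.A 0 ω| * |x'| ≤ |S.A 0 ω| * s := by gcongr; linarith
        linarith
      have := Real.rpow_le_rpow (by positivity) hbase (by linarith : 0 ≤ p - 1)
      calc C * (|S.A 0 ω - 1| * |x - x'|) *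
            (1 + |y - x'| + |S.A 0 ω - 1| * |x - x'|) ^ (p - 1)
          ≤ C * ((1 + |S.A 0 ω|) * |x - x'|) *
            (1 + 2 * s + |S.A 0 ω| * (2 * s) + 1 * S.drift 0 ω) ^ (p - 1) := by gcongr
        _ = _ := by ring
    have f2 : K * (|S.A 0 ω| * |x - x'|) *
        (k + |y + S.A 0 ω * (x - x')| + |y|) ^ (p - 1) ≤
        K * |x - x'| * (|S.A 0 ω| * (k + |S.A 0 ω| * s + 2 * S.drift 0 ω) ^ (p - 1)) := by
      have hbase : k + |y + S.A 0 ω * (x - x')| + |y| ≤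
          k + |S.A 0 ω| * s + 2 * S.drift 0 ω := by
        have : |S.A 0 ω| * s = |S.A 0 ω| * |x| + |S.A 0 ω| * |x'| := by rw [hs]; ring
        linarith
      have := Real.rpow_le_rpow (by positivity) hbase (by linarith : 0 ≤ p - 1)
      calc K * (|S.A 0 ω| * |x - x'|) * (k + |y + S.A 0 ω * (x - x')| + |y|) ^ (p - 1)
          ≤ K * (|S.A 0 ω| * |x - x'|) *
            (k + |S.A 0 ω| * s + 2 * S.drift 0 ω) ^ (p - 1) := by gcongr
        _ = _ := by ring
    linarith
  have hint := integral_mono_ae ((hi x).sub (hi x'))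
    ((i2.const_mul (C * |x - x'|)).add (i1.const_mul (K * |x - x'|))) hpt
  simp only [Pi.sub_apply, Pi.add_apply] at hint
  rw [integral_sub (hi x) (hi x'), integral_add (i2.const_mul _) (i1.const_mul _),
    integral_const_mul, integral_const_mul] at hint
  rw [add_assoc, ← hs]
  have w0 : 0 ≤ (k + s) ^ (p - 1) := by positivity
  calc bellman μ S f h x - bellman μ S f h x'
      ≤ C * |x - x'| * (L * (k + s) ^ (p - 1)) + K * |x - x'| * (θ * (k + s) ^ (p - 1)) := by
        refine hint.trans (add_le_add ?_ ?_)
        · exact mul_le_mul_of_nonneg_left b2 (by positivity)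
        · exact mul_le_mul_of_nonneg_left b1 (by positivity)
    _ = (C * L + K * θ) * |x - x'| * (k + s) ^ (p - 1) := by ring
    _ = K * |x - x'| * (k + s) ^ (p - 1) := by rw [hKeq]

end BellmanTame

/-! ### Existence of a relative value function by vanishing discount -/

/-- Tame functions with a common value at `0` form a sequentially compact set for pointwise
convergence: extract a subsequence that converges on the rationals and use equicontinuity. -/
theorem TameValue.exists_subseq_tendsto {K k : ℝ} {H : ℕ → ℝ → ℝ} (hp : 1 ≤ p) (hK : 0 ≤ K)
    (hk : 1 ≤ k) (hH : ∀ n, TameValue p K k (H n)) (h0 : ∀ n, H n 0 = 0) :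
    ∃ (φ : ℕ → ℕ) (h : ℝ → ℝ), StrictMono φ ∧
      ∀ x, Tendsto (fun n => H (φ n) x) atTop (𝓝 (h x)) := by
  have hb : ∀ n x, |H n x| ≤ K * k ^ p * (1 + |x|) ^ p := fun n x => by
    simpa [h0 n] using (hH n).growth_le hp hK hk x
  have hcomp : IsCompact (Set.pi univ fun q : ℚ =>
      Icc (-(K * k ^ p * (1 + |(q : ℝ)|) ^ p)) (K * k ^ p * (1 + |(q : ℝ)|) ^ p)) :=
    isCompact_univ_pi fun q => isCompact_Icc
  obtain ⟨a, -, φ, hφ, hlim⟩ := hcomp.tendsto_subseq (x := fun n (q : ℚ) => H n q)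
    fun n q _ => abs_le.1 (hb n q)
  rw [tendsto_pi_nhds] at hlim
  have hcauchy : ∀ x, CauchySeq fun n => H (φ n) x := by
    intro x
    rw [Metric.cauchySeq_iff']
    intro ε hε
    have hcont : Tendsto (fun z : ℝ => K * |x - z| * (k + |x| + |z|) ^ (p - 1)) (𝓝 x) (𝓝 0) := by
      have : Continuous fun z : ℝ => K * |x - z| * (k + |x| + |z|) ^ (p - 1) := by
        refine Continuous.mul (by fun_prop) (Continuous.rpow_const (by fun_prop) fun z => ?_)
        right; linarith
      simpa using this.tendsto x
    obtain ⟨q, hq⟩ := Rat.denseRange_cast.exists_mem_open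
      (isOpen_interior (s := {z : ℝ | K * |x - z| * (k + |x| + |z|) ^ (p - 1) < ε / 3}))
      ⟨x, mem_interior_iff_mem_nhds.2 (hcont.eventually (gt_mem_nhds (by positivity)))⟩
    replace hq := interior_subset hq
    rw [mem_ofPred_eq] at hq
    obtain ⟨N, hN⟩ := Metric.cauchySeq_iff'.1 (hlim q).cauchySeq (ε / 3) (by positivity)
    refine ⟨N, fun n hn => ?_⟩
    have e1 := abs_le.1 ((hH (φ n)).abs_sub_le x q)
    have e2 := abs_le.1 ((hH (φ N)).abs_sub_le x q)
    have e3 : |H (φ n) q - H (φ N) q| < ε / 3 := hN n hn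
    rw [abs_lt] at e3
    rw [Real.dist_eq, abs_lt]
    constructor <;> linarith
  choose h hh using fun x => cauchySeq_tendsto_of_complete (hcauchy x)
  exact ⟨φ, h, hφ, hh⟩

section VanishingDiscount

variable [IsProbabilityMeasure μ] {f : ℝ → ℝ} {K k : ℝ}

theorem bellman_add_const {h : ℝ → ℝ} (hS : TransitionDynamics μ 𝓕 S) (hp : LpStable μ S p)
    (hf : IncrementCost p f) (hh : Continuous h) (hg : HasGrowth p h) (a x : ℝ) :
    bellman μ S f (fun y => h y + a) x = bellman μ S f h x + a := by
  have : bellman μ S f (fun y => h y + a) x = ∫ ω, (stepValue S (incr f) h x ω + a) ∂μ := by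
    refine integral_congr_ae ?_
    filter_upwards [hS.interval 0] with ω hω
    exact stepValue_add_const hω hf.continuous hh x a
  rw [this, integral_add (integrable_stepValue hS hp hf hh hg x) (integrable_const a)]
  simp [bellman]

theorem bellman_mono {h₁ h₂ : ℝ → ℝ} (hS : TransitionDynamics μ 𝓕 S) (hp : LpStable μ S p)
    (hf : IncrementCost p f) (hh₁ : Continuous h₁) (hg₁ : HasGrowth p h₁)
    (hh₂ : Continuous h₂) (hg₂ : HasGrowth p h₂) (hle : ∀ y, h₁ y ≤ h₂ y) (x : ℝ) :
    bellman μ S f h₁ x ≤ bellman μ S f h₂ x := by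
  refine integral_mono_ae (integrable_stepValue hS hp hf hh₁ hg₁ x)
    (integrable_stepValue hS hp hf hh₂ hg₂ x) ?_
  filter_upwards [hS.interval 0] with ω hω
  exact stepValue_mono hω hf.continuous hh₁ hle x

/-- The `n`-period value function with discount factor `b`. -/
noncomputable def discountedValue (μ : Measure Ω) (S : Shocks Ω) (f : ℝ → ℝ) (b : ℝ) :
    ℕ → ℝ → ℝ
  | 0 => fun _ => 0
  | n + 1 => bellman μ S f fun y => b * discountedValue μ S f b n y

/-- The discounted problem has a tame value function `V = T (b V)`; in terms of `h = V - V 0` this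
is the average cost equation up to the discount factor. -/
theorem exists_discounted_relative_value (hS : TransitionDynamics μ 𝓕 S) (hp : LpStable μ S p)
    (hf : IncrementCost p f) (hK : 0 ≤ K) (hk : 1 ≤ k)
    (htame : ∀ h, TameValue p K k h → TameValue p K k (bellman μ S f h))
    {b : ℝ} (hb0 : 0 ≤ b) (hb1 : b < 1) :
    ∃ (h : ℝ → ℝ) (lam : ℝ), TameValue p K k h ∧ h 0 = 0 ∧
      ∀ x, lam + h x = bellman μ S f (fun y => b * h y) x := by
  have h2 := hp.two_le
  have hp1 : 1 ≤ p := by linarith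
  have hk0 : 0 ≤ k := by linarith
  set W := discountedValue μ S f b with hW
  have hWs : ∀ n, W (n + 1) = bellman μ S f fun y => b * W n y := fun n => rfl
  have ht : ∀ n, TameValue p K k (W n) := by
    intro n
    induction n with
    | zero => exact TameValue.zero hK hk0
    | succ n ih => exact htame _ (ih.smul hK hk0 hb0 hb1.le)
  have htb : ∀ n, TameValue p K k fun y => b * W n y := fun n => (ht n).smul hK hk0 hb0 hb1.le
  have hmono : ∀ n x, W n x ≤ W (n + 1) x := by
    intro n
    induction n with
    | zero =>
      intro x
      refine integral_nonneg_of_ae ?_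
      filter_upwards [hS.interval 0] with ω hω
      refine le_stepValue hω fun y _ => ?_
      have := hf.nonneg (y - x)
      simpa [discountedValue] using this
    | succ n ih =>
      intro x
      rw [hWs n, hWs (n + 1)]
      exact bellman_mono hS hp hf (htb _).continuous ((htb _).hasGrowth hp1 hK hk)
        (htb _).continuous ((htb _).hasGrowth hp1 hK hk)
        (fun y => mul_le_mul_of_nonneg_left (ih y) hb0) x
  obtain ⟨bd, hbd, hbound⟩ := exists_abs_stepValue_le hS hp hf hK hk 0 0
  set M := ∫ ω, bd ω ∂μ with hM
  have hW0 : ∀ n, W n 0 ≤ M / (1 - b) := by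
    have hb1' : 0 < 1 - b := by linarith
    have hbell : ∀ h, TameValue p K k h → |h 0| ≤ 0 → bellman μ S f h 0 ≤ M := by
      intro h hh h0
      refine integral_mono_ae (integrable_stepValue hS hp hf hh.continuous
        (hh.hasGrowth hp1 hK hk) 0) hbd ?_
      filter_upwards [hbound h hh h0] with ω hω using (le_abs_self _).trans hω
    have hM0 : 0 ≤ M := by
      have e1 := hbell _ (TameValue.zero hK hk0) (by simp)
      have e2 := hmono 0 0
      have e3 : W (0 + 1) 0 = bellman μ S f (fun _ => 0) 0 := by
        rw [hWs]
        congr 1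
        funext y
        simp [hW, discountedValue]
      have e4 : W 0 0 = 0 := rfl
      linarith
    intro n
    induction n with
    | zero => exact div_nonneg hM0 hb1'.le
    | succ n ih =>
      have htn := (htb n).add_const (-(b * W n 0))
      have e1 := bellman_add_const hS hp hf htn.continuous (htn.hasGrowth hp1 hK hk) (b * W n 0) 0
      have e2 := hbell _ htn (by simp)
      have e3 : W (n + 1) 0 =
          bellman μ S f (fun y => b * W n y + -(b * W n 0) + b * W n 0) 0 := by
        rw [hWs]; simp
      rw [e3, e1]
      rw [le_div_iff₀ hb1'] at ih ⊢
      nlinarith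
  have hbdd : ∀ x, BddAbove (range fun n => W n x) := by
    intro x
    refine ⟨M / (1 - b) + K * |x - 0| * (k + |x| + |(0 : ℝ)|) ^ (p - 1), ?_⟩
    rintro _ ⟨n, rfl⟩
    have e : W n x = W n 0 + (W n x - W n 0) := by ring
    exact e.le.trans (add_le_add (hW0 n) ((ht n).sub_le x 0))
  have hlim : ∀ x, Tendsto (fun n => W n x) atTop (𝓝 (⨆ n, W n x)) := fun x =>
    tendsto_atTop_ciSup (monotone_nat_of_le_succ fun n => hmono n x) (hbdd x)
  set V : ℝ → ℝ := fun x => ⨆ n, W n x with hV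
  have hVt : TameValue p K k V := TameValue.of_tendsto ht hlim
  have hVeq : ∀ x, V x = bellman μ S f (fun y => b * V y) x := by
    intro x
    have e1 := tendsto_bellman hS hp hf hK hk htb (fun x => (hlim x).const_mul b) x
    have e2 := (hlim x).comp (tendsto_add_atTop_nat 1)
    exact tendsto_nhds_unique e2 e1
  have hht : TameValue p K k fun y => V y + -V 0 := hVt.add_const _
  have hbht := hht.smul hK hk0 hb0 hb1.le
  refine ⟨fun y => V y + -V 0, (1 - b) * V 0, hht, by simp, fun x => ?_⟩
  have e1 := bellman_add_const hS hp hf hbht.continuous (hbht.hasGrowth hp1 hK hk) (b * V 0) x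
  have e2 : (fun y => b * (V y + -V 0) + b * V 0) = fun y => b * V y := by
    funext y; ring
  rw [e2, ← hVeq] at e1
  simp only
  linarith

theorem exists_isRelativeValue (hS : TransitionDynamics μ 𝓕 S) (hp : LpStable μ S p)
    (hf : IncrementCost p f) : ∃ lam h, IsRelativeValue μ S p (incr f) lam h := by
  have h2 := hp.two_le
  have hp1 : 1 ≤ p := by linarith
  obtain ⟨K, k, hK, hk, htame⟩ := exists_tame_bellman hS hp hf
  have hk0 : 0 ≤ k := by linarith
  set b : ℕ → ℝ := fun n => n / (n + 1) with hb
  have hb0 : ∀ n, 0 ≤ b n := fun n => by positivity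
  have hb1 : ∀ n, b n < 1 := fun n => by
    rw [hb]; simp only; rw [div_lt_one (by positivity)]; linarith
  choose H lam hH hH0 hHeq using fun n =>
    exists_discounted_relative_value hS hp hf hK hk htame (hb0 n) (hb1 n)
  obtain ⟨φ, h, hφ, hlim⟩ := TameValue.exists_subseq_tendsto hp1 hK hk hH hH0
  have hh : TameValue p K k h := TameValue.of_tendsto (fun n => hH (φ n)) hlim
  have hblim : Tendsto (fun n => b (φ n)) atTop (𝓝 1) :=
    (tendsto_natCast_div_add_atTop (1 : ℝ)).comp hφ.tendsto_atTop
  have hT : ∀ x, Tendsto (fun n => bellman μ S f (fun y => b (φ n) * H (φ n) y) x) atTop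
      (𝓝 (bellman μ S f h x)) := by
    intro x
    refine tendsto_bellman hS hp hf hK hk
      (fun n => (hH (φ n)).smul hK hk0 (hb0 _) (hb1 _).le) (fun x => ?_) x
    simpa using hblim.mul (hlim x)
  have h0 : h 0 = 0 := tendsto_nhds_unique (hlim 0) (by simp [hH0])
  have hg := hh.hasGrowth hp1 hK hk
  refine ⟨bellman μ S f h 0, h, hh.convex, ?_,
    fun x => integrable_stepValue hS hp hf hh.continuous hg x, fun x => ?_⟩
  · obtain ⟨C, hC⟩ := hg
    have hC0 : 0 ≤ C := by simpa using (abs_nonneg (h 0)).trans (hC 0)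
    refine ⟨C * 2 ^ (p - 1), fun x => (hC x).trans ?_⟩
    rw [mul_assoc]
    refine mul_le_mul_of_nonneg_left ?_ hC0
    have := NNReal.coe_le_coe.2 (NNReal.rpow_add_le_mul_rpow_add_rpow 1 ‖x‖₊ hp1)
    simpa using this
  · have e1 := (hT x).sub (hT 0)
    have e2 : ∀ n, bellman μ S f (fun y => b (φ n) * H (φ n) y) x -
        bellman μ S f (fun y => b (φ n) * H (φ n) y) 0 = H (φ n) x := fun n => by
      rw [← hHeq, ← hHeq, hH0]; ring
    simp only [e2] at e1
    have := tendsto_nhds_unique (hlim x) e1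
    change bellman μ S f h 0 + h x = bellman μ S f h x
    linarith

end VanishingDiscount

/-! ### Coercivity and smoothness of relative value functions -/

section RelativeValue

variable {f h : ℝ → ℝ} {lam : ℝ}

theorem IsRelativeValue.continuous (hh : IsRelativeValue μ S p (incr f) lam h) : Continuous h :=
  continuous_of_convexOn_univ hh.convex

theorem IsRelativeValue.eq_bellman (hh : IsRelativeValue μ S p (incr f) lam h) (x : ℝ) :
    h x = bellman μ S f h x - lam := by
  have : lam + h x = bellman μ S f h x := hh.optimality x
  linarith

/-- A relative value function does not decrease forever in the direction `σ = ±1`. Otherwise, far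
out in that direction, the next action has on average a smaller absolute value, hence a larger
relative value, so the adjustment cost alone, which grows linearly, would be at most `lam`. -/
theorem IsRelativeValue.not_antitone_direction [IsProbabilityMeasure μ]
    (hS : TransitionDynamics μ 𝓕 S)
    (hp : LpStable μ S p) (hf : IncrementCost p f)
    (hh : IsRelativeValue μ S p (incr f) lam h) {σ : ℝ} (hσ : |σ| = 1)
    (hanti : ∀ s t, s ≤ t → h (σ * t) ≤ h (σ * s)) : False := by
  obtain ⟨ε, hε, hlin⟩ := hf.exists_linear_lower
  obtain ⟨iA, hA⟩ := hS.integral_abs_A_lt_one hp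
  have iR := hS.integrable_drift hp
  set a := ∫ ω, |S.A 0 ω| ∂μ with ha
  set R := ∫ ω, S.drift 0 ω ∂μ with hR
  have hR0 : 0 ≤ R := integral_nonneg (S.drift_nonneg 0)
  have hσσ : σ * σ = 1 := by rw [← abs_mul_abs_self, hσ, one_mul]
  have h1a : 0 < 1 - a := by linarith
  set t := (R + 1 + (|lam| + 1) / ε) / (1 - a) with ht
  have ht0 : 0 ≤ t := by positivity
  have hta : (1 - a) * t = R + 1 + (|lam| + 1) / ε := by rw [ht]; field_simp
  obtain ⟨m, hm⟩ := exists_support_line hh.convex (σ * t)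
  have hσm : σ * m ≤ 0 := by
    have e1 := hm (σ * (t + 1))
    have e2 := hanti t (t + 1) (by linarith)
    nlinarith
  have hpt : ∀ᵐ ω ∂μ, (ε * (t - 1) + h (σ * t) - σ * m * t) +
      ((σ * m - ε) * t * |S.A 0 ω| + (σ * m - ε) * S.drift 0 ω) ≤
      stepValue S (incr f) h (σ * t) ω := by
    filter_upwards [hS.interval 0] with ω hω
    refine le_stepValue hω fun y hy => ?_
    have hy' := Shocks.abs_le_of_mem_feasible hy
    rw [abs_mul, hσ, one_mul, abs_of_nonneg ht0] at hy'
    have e1 := hm y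
    have e2 := hlin (y - σ * t)
    have e3 : t - |y| ≤ |y - σ * t| := by
      have := abs_sub_abs_le_abs_sub (σ * t) y
      rw [abs_mul, hσ, one_mul, abs_of_nonneg ht0, abs_sub_comm] at this
      exact this
    have e4 : σ * y ≤ |y| := by
      have := le_abs_self (σ * y)
      rwa [abs_mul, hσ, one_mul] at this
    have e5 : m * (y - σ * t) = σ * m * (σ * y - t) := by
      linear_combination (-(m * y)) * hσσ
    have e6 : ε * (t - (|S.A 0 ω| * t + S.drift 0 ω) - 1) ≤ ε * (|y - σ * t| - 1) :=
      mul_le_mul_of_nonneg_left (by linarith) hε.le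
    have e7 : σ * m * (|S.A 0 ω| * t + S.drift 0 ω) ≤ σ * m * (σ * y) :=
      mul_le_mul_of_nonpos_left (by linarith) hσm
    rw [e5] at e1
    linarith
  have i1 : Integrable (fun ω => (σ * m - ε) * t * |S.A 0 ω|) μ := iA.const_mul _
  have i2 : Integrable (fun ω => (σ * m - ε) * S.drift 0 ω) μ := iR.const_mul _
  have i12 : Integrable (fun ω => (σ * m - ε) * t * |S.A 0 ω| + (σ * m - ε) * S.drift 0 ω) μ :=
    i1.add i2
  have hint := integral_mono_ae ((integrable_const (ε * (t - 1) + h (σ * t) - σ * m * t)).add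
    i12) (hh.integrable (σ * t)) hpt
  simp only [Pi.add_apply] at hint
  rw [← hh.optimality, integral_add (integrable_const _) i12, integral_add i1 i2, integral_const_mul, integral_const_mul, ← ha, ← hR] at hint
  simp only [integral_const, probReal_univ, one_smul] at hint
  have e8 : 0 ≤ -(σ * m) * ((1 - a) * t - R) := by
    refine mul_nonneg (by linarith) ?_
    rw [hta]
    have : 0 ≤ (|lam| + 1) / ε := by positivity
    linarith
  have e9 : ε * ((1 - a) * t - R - 1) = |lam| + 1 := by
    rw [hta]; field_simp; ring
  have := le_abs_self lam
  nlinarith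

theorem IsRelativeValue.exists_min [IsProbabilityMeasure μ]
    (hS : TransitionDynamics μ 𝓕 S) (hp : LpStable μ S p)
    (hf : IncrementCost p f) (hh : IsRelativeValue μ S p (incr f) lam h) :
    (∃ q, ∀ y, h q ≤ h y) ∧ ∃ lo hi, ∀ q, (∀ y, h q ≤ h y) → q ∈ Icc lo hi := by
  refine exists_min_of_not_monotone hh.convex (fun hanti => ?_) fun hmono => ?_
  · exact hh.not_antitone_direction hS hp hf (σ := 1) (by simp) fun s t hst => by
      simpa using hanti hst
  · exact hh.not_antitone_direction hS hp hf (σ := -1) (by simp) fun s t hst =>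
      hmono (by linarith)

/-- Moving the optimal action along with the previous one shows that a kink of the minimized value
is inherited from a kink of `h` at the next action, scaled by `|A|`. -/
theorem exists_kink_stepValue_le (hf : IncrementCost p f) (hh : ConvexOn ℝ univ h) {ω : Ω}
    (hω : S.U 0 ω ≤ S.V 0 ω) (x : ℝ) :
    ∃ y ∈ S.feasible 0 x ω,
      kink (fun x => stepValue S (incr f) h x ω) x ≤ |S.A 0 ω| * kink h y := by
  have hhc := continuous_of_convexOn_univ hh
  obtain ⟨y, hy, he⟩ := exists_stepValue_eq (x := x) hf.continuous hhc hω
  refine ⟨y, hy, ?_⟩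
  have l1 := tendsto_secondDiff (convexOn_stepValue (S := S) hω hf.convex hh) x
  have l2 := (tendsto_secondDiff_scaled hf.convex (y - x) (S.A 0 ω - 1)).add
    (tendsto_secondDiff_scaled hh y (S.A 0 ω))
  rw [kink_eq_zero_of_differentiableAt (hf.differentiable (y - x)), mul_zero, zero_add] at l2
  refine le_of_tendsto_of_tendsto l1 l2 ?_
  filter_upwards [self_mem_nhdsWithin] with t ht
  have ht : 0 < t := ht
  rw [secondDiff, ← add_div]
  refine div_le_div_of_nonneg_right ?_ ht.le
  have e1 := stepValue_le hf.continuous hhc (Shocks.add_mem_feasible hy t)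
  have e2 := stepValue_le hf.continuous hhc (Shocks.add_mem_feasible hy (-t))
  rw [show y + S.A 0 ω * t - (x + t) = y - x + (S.A 0 ω - 1) * t by ring] at e1
  rw [show y + S.A 0 ω * -t - (x + -t) = y - x - (S.A 0 ω - 1) * t by ring,
    show y + S.A 0 ω * -t = y - S.A 0 ω * t by ring, ← sub_eq_add_neg] at e2
  linarith

/-- The kink of an expectation is the expectation of the kinks. -/
theorem IsRelativeValue.kink_le_integral (hS : TransitionDynamics μ 𝓕 S) (hf : IncrementCost p f)
    (hh : IsRelativeValue μ S p (incr f) lam h) (x : ℝ) {b : Ω → ℝ} (hb : Integrable b μ)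
    (hle : ∀ᵐ ω ∂μ, kink (fun x => stepValue S (incr f) h x ω) x ≤ b ω) :
    kink h x ≤ ∫ ω, b ω ∂μ := by
  set g : Ω → ℝ → ℝ := fun ω x => stepValue S (incr f) h x ω with hg
  set t : ℕ → ℝ := fun n => 1 / ((n : ℝ) + 1) with ht
  have ht0 : ∀ n, 0 < t n := fun n => by positivity
  have ht1 : ∀ n, t n ≤ 1 := fun n => by
    rw [ht]; simp only
    rw [div_le_one (by positivity)]
    linarith [Nat.cast_nonneg (α := ℝ) n]
  have htlim : Tendsto t atTop (𝓝[>] 0) :=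
    tendsto_nhdsWithin_iff.2 ⟨tendsto_one_div_add_atTop_nhds_zero_nat,
      Eventually.of_forall ht0⟩
  have hi : ∀ s, Integrable (fun ω => secondDiff (g ω) x s) μ := fun s =>
    (((hh.integrable (x + s)).add (hh.integrable (x - s))).sub
      ((hh.integrable x).const_mul 2)).div_const s
  have hsd : ∀ s, secondDiff h x s = ∫ ω, secondDiff (g ω) x s ∂μ := by
    intro s
    simp only [secondDiff]
    rw [integral_div, integral_sub, integral_add, integral_const_mul]
    · rw [hh.eq_bellman (x + s), hh.eq_bellman (x - s), hh.eq_bellman x]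
      simp only [bellman, hg]
      congr 1
      ring
    · exact hh.integrable _
    · exact hh.integrable _
    · exact (hh.integrable _).add (hh.integrable _)
    · exact (hh.integrable _).const_mul 2
  have hconv : ∀ᵐ ω ∂μ, ConvexOn ℝ univ (g ω) := by
    filter_upwards [hS.interval 0] with ω hω
    exact convexOn_stepValue hω hf.convex hh.convex
  have hlim : Tendsto (fun n => ∫ ω, secondDiff (g ω) x (t n) ∂μ) atTop
      (𝓝 (∫ ω, kink (g ω) x ∂μ)) := by
    refine tendsto_integral_of_dominated_convergence (fun ω => secondDiff (g ω) x 1)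
      (fun n => (hi _).aestronglyMeasurable) (hi 1) (fun n => ?_) ?_
    · filter_upwards [hconv] with ω hω
      rw [Real.norm_of_nonneg (secondDiff_nonneg hω x (ht0 n))]
      exact secondDiff_mono hω x (ht0 n) (ht1 n)
    · filter_upwards [hconv] with ω hω
      exact (tendsto_secondDiff hω x).comp htlim
  have hk : kink h x ≤ ∫ ω, kink (g ω) x ∂μ :=
    ge_of_tendsto' hlim fun n => by
      rw [← hsd]
      exact kink_le_secondDiff hh.convex x (ht0 n)
  refine hk.trans (integral_mono_of_nonneg ?_ hb hle)
  filter_upwards [hconv] with ω hω using kink_nonneg hω x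

/-- A relative value function is differentiable: the kinks are of order `|x| ^ (p - 1)` and are
contracted by the optimality equation in a weighted supremum norm. -/
theorem IsRelativeValue.differentiable [IsProbabilityMeasure μ]
    (hS : TransitionDynamics μ 𝓕 S) (hp : LpStable μ S p)
    (hf : IncrementCost p f) (hh : IsRelativeValue μ S p (incr f) lam h) :
    Differentiable ℝ h := by
  have h2 := hp.two_le
  obtain ⟨k, θ, hk, hθ0, hθ1, hcontr⟩ := hS.exists_weight_contraction hp
  obtain ⟨C, hC⟩ := HasGrowth.of_le (by linarith : 0 ≤ p) hh.growth
  have hC0 : 0 ≤ C := by simpa using (abs_nonneg (h 0)).trans (hC 0)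
  have hbase : ∀ x, kink h x ≤ 4 * C * 3 ^ p * k * (k + |x|) ^ (p - 1) := by
    intro x
    have hx := abs_nonneg x
    set s := k + |x| with hs
    have hs0 : 0 < s := by linarith
    have hgr : ∀ z, |z| ≤ 2 * s → |h z| ≤ C * (3 ^ p * s ^ p) := fun z hz => by
      refine (hC z).trans (mul_le_mul_of_nonneg_left ?_ hC0)
      rw [← Real.mul_rpow (by norm_num) hs0.le]
      exact Real.rpow_le_rpow (by positivity) (by linarith) (by linarith)
    have b1 := abs_le.1 (hgr (x + s) (by
      have := abs_add_le x s; rw [abs_of_pos hs0] at this; linarith))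
    have b2 := abs_le.1 (hgr (x - s) (by
      have := abs_sub x s; rw [abs_of_pos hs0] at this; linarith))
    have b3 := abs_le.1 (hgr x (by linarith))
    refine (kink_le_secondDiff hh.convex x hs0).trans ?_
    rw [secondDiff, div_le_iff₀ hs0]
    have e : s ^ p = s ^ (p - 1) * s := by
      rw [← Real.rpow_add_one hs0.ne']; ring_nf
    have e2 : 4 * C * 3 ^ p * k * s ^ (p - 1) * s = k * (4 * (C * (3 ^ p * s ^ p))) := by
      rw [e]; ring
    rw [e2]
    have e3 : 0 ≤ C * (3 ^ p * s ^ p) := by positivity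
    nlinarith
  have hstep : ∀ M, 0 ≤ M → (∀ x, kink h x ≤ M * (k + |x|) ^ (p - 1)) →
      ∀ x, kink h x ≤ M * θ * (k + |x|) ^ (p - 1) := by
    intro M hM hb x
    obtain ⟨i1, hle⟩ := hcontr |x| (abs_nonneg x)
    have hpt : ∀ᵐ ω ∂μ, kink (fun x => stepValue S (incr f) h x ω) x ≤
        M * (|S.A 0 ω| * (k + |S.A 0 ω| * |x| + 2 * S.drift 0 ω) ^ (p - 1)) := by
      filter_upwards [hS.interval 0] with ω hω
      obtain ⟨y, hy, hky⟩ := exists_kink_stepValue_le hf hh.convex hω x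
      have hy' := Shocks.abs_le_of_mem_feasible hy
      have hd := S.drift_nonneg 0 ω
      have e1 : kink h y ≤ M * (k + |S.A 0 ω| * |x| + 2 * S.drift 0 ω) ^ (p - 1) := by
        refine (hb y).trans (mul_le_mul_of_nonneg_left ?_ hM)
        exact Real.rpow_le_rpow (by positivity) (by linarith) (by linarith)
      have e2 := mul_le_mul_of_nonneg_left e1 (abs_nonneg (S.A 0 ω))
      linarith
    have := hh.kink_le_integral hS hf x (i1.const_mul M) hpt
    rw [integral_const_mul] at this
    rw [mul_assoc]
    exact this.trans (mul_le_mul_of_nonneg_left hle hM)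
  set M₀ := 4 * C * 3 ^ p * k with hM₀
  have hM₀0 : 0 ≤ M₀ := by positivity
  have hiter : ∀ n : ℕ, ∀ x, kink h x ≤ M₀ * θ ^ n * (k + |x|) ^ (p - 1) := by
    intro n
    induction n with
    | zero => simpa using hbase
    | succ n ih =>
      intro x
      have := hstep _ (by positivity) ih x
      rwa [mul_assoc M₀, ← pow_succ] at this
  intro x
  refine differentiableAt_of_kink_eq_zero hh.convex (le_antisymm ?_ (kink_nonneg hh.convex x))
  have hlim : Tendsto (fun n : ℕ => M₀ * θ ^ n * (k + |x|) ^ (p - 1)) atTop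
      (𝓝 (M₀ * 0 * (k + |x|) ^ (p - 1))) :=
    ((tendsto_pow_atTop_nhds_zero_of_lt_one hθ0 hθ1).const_mul M₀).mul_const _
  rw [mul_zero, zero_mul] at hlim
  exact ge_of_tendsto' hlim fun n => hiter n x

end RelativeValue

/-! ### The target function -/

theorem convexOn_univ_four_point {h : ℝ → ℝ} (hh : ConvexOn ℝ univ h) {a b c d : ℝ} (hab : a ≤ b)
    (hac : a ≤ c) (hsum : b + c = a + d) : h b + h c ≤ h a + h d := by
  rcases eq_or_ne a d with rfl | had
  · obtain rfl : b = a := by linarith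
    obtain rfl : c = b := by linarith
    exact le_rfl
  · have hd : 0 < d - a := by
      rcases lt_or_gt_of_ne had with h' | h'
      · linarith
      · linarith
    have e1 := convexOn_univ_le hh a d (t := (b - a) / (d - a)) (by
      exact div_nonneg (by linarith) hd.le) (by rw [div_le_one hd]; linarith)
    have e2 := convexOn_univ_le hh a d (t := (c - a) / (d - a)) (by
      exact div_nonneg (by linarith) hd.le) (by rw [div_le_one hd]; linarith)
    have hts : (b - a) / (d - a) + (c - a) / (d - a) = 1 := by
      rw [← add_div, div_eq_one_iff_eq hd.ne']; linarith
    have r1 : (1 - (b - a) / (d - a)) * a + (b - a) / (d - a) * d = b := by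
      field_simp; ring
    have r2 : (1 - (c - a) / (d - a)) * a + (c - a) / (d - a) * d = c := by
      field_simp; ring
    rw [r1] at e1
    rw [r2] at e2
    have e3 : (c - a) / (d - a) = 1 - (b - a) / (d - a) := by linarith
    rw [e3] at e2
    linarith

theorem min_max_mem_Icc {l u : ℝ} (hlu : l ≤ u) (a : ℝ) : min (max a l) u ∈ Icc l u :=
  ⟨le_min (le_max_right _ _) hlu, min_le_right _ _⟩

/-- The projection onto an interval of a global minimizer of a convex function minimizes the
function over the interval. -/
theorem le_of_project_minimizer {φ : ℝ → ℝ} (hφ : ConvexOn ℝ univ φ) {a l u z : ℝ}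
    (ha : ∀ w, φ a ≤ φ w) (hz : z ∈ Icc l u) : φ (min (max a l) u) ≤ φ z := by
  obtain ⟨h1, h2⟩ := hz
  have hm : ∀ y, y ∈ Icc a z → φ y ≤ φ z := fun y hy =>
    (hφ.le_max_of_mem_Icc (mem_univ a) (mem_univ z) hy).trans (max_le (ha z) le_rfl)
  have hm' : ∀ y, y ∈ Icc z a → φ y ≤ φ z := fun y hy =>
    (hφ.le_max_of_mem_Icc (mem_univ z) (mem_univ a) hy).trans (max_le le_rfl (ha z))
  rcases le_total a l with hal | hal
  · rw [max_eq_right hal, min_eq_left (h1.trans h2)]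
    exact hm l ⟨hal, h1⟩
  · rw [max_eq_left hal]
    rcases le_total a u with hau | hau
    · rw [min_eq_left hau]
      exact ha z
    · rw [min_eq_right hau]
      exact hm' u ⟨h2, hau⟩

/-- `h` is affine at the midpoint of `x` and `y`. For convex `h` this says that `h` is affine between
`x` and `y`. -/
def MidAffine (h : ℝ → ℝ) (x y : ℝ) : Prop := h ((x + y) / 2) = (h x + h y) / 2

theorem support_line_deriv {h : ℝ → ℝ} (hh : ConvexOn ℝ univ h) (hd : Differentiable ℝ h)
    (x z : ℝ) : h x + deriv h x * (z - x) ≤ h z := by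
  obtain ⟨m, hm⟩ := exists_support_line hh x
  have h1 : HasDerivAt (fun z => h z - m * (z - x)) (deriv h x - m * 1) x :=
    (hd x).hasDerivAt.sub (((hasDerivAt_id x).sub_const x).const_mul m)
  have h2 : IsLocalMin (fun z => h z - m * (z - x)) x := by
    refine Eventually.of_forall fun z => ?_
    have := hm z
    simp only [sub_self, mul_zero, sub_zero]
    linarith
  have h3 := h2.hasDerivAt_eq_zero h1
  obtain rfl : m = deriv h x := by linarith
  exact hm z

theorem midAffine_of_deriv_eq {h : ℝ → ℝ} (hh : ConvexOn ℝ univ h) (hd : Differentiable ℝ h)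
    {x y : ℝ} (he : deriv h x = deriv h y) : MidAffine h x y := by
  have e1 := support_line_deriv hh hd x y
  have e2 := support_line_deriv hh hd y x
  have e3 := support_line_deriv hh hd x ((x + y) / 2)
  have e4 := convexOn_univ_midpoint hh x y
  rw [← he] at e2
  refine le_antisymm e4 ?_
  linarith

theorem not_midAffine_of_strictConvexOn {h : ℝ → ℝ} (hh : StrictConvexOn ℝ univ h) {x y : ℝ}
    (hxy : x ≠ y) : ¬ MidAffine h x y := by
  intro hm
  have := hh.2 (mem_univ x) (mem_univ y) hxy (show (0 : ℝ) < 1 / 2 by norm_num)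
    (show (0 : ℝ) < 1 / 2 by norm_num) (by norm_num)
  simp only [smul_eq_mul] at this
  rw [show 1 / 2 * x + 1 / 2 * y = (x + y) / 2 by ring, hm] at this
  linarith

section Target

variable {f h r : ℝ → ℝ}

theorem convexOn_objective (hf : IncrementCost p f) (hh : ConvexOn ℝ univ h) (x : ℝ) :
    ConvexOn ℝ univ fun y => f (y - x) + h y := by
  refine ConvexOn.add ⟨convex_univ, fun y _ z _ a b ha hb hab => ?_⟩ hh
  have e : a • y + b • z - x = a • (y - x) + b • (z - x) := by
    simp only [smul_eq_mul]
    linear_combination x * hab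
  simp only [e]
  exact hf.convex.2 (mem_univ _) (mem_univ _) ha hb hab

theorem exists_isTarget (hf : IncrementCost p f) (hh : ConvexOn ℝ univ h) {q : ℝ}
    (hq : ∀ y, h q ≤ h y) : ∃ r, IsTarget (incr f) h r := by
  have hhc := continuous_of_convexOn_univ hh
  obtain ⟨ε, hε, hlin⟩ := hf.exists_linear_lower
  have key : ∀ x, ∃ y, ∀ z, z ≠ y → f (y - x) + h y < f (z - x) + h z := by
    intro x
    have hc : Continuous fun y => f (y - x) + h y := by
      have := hf.continuous
      fun_prop
    have hcoer : Tendsto (fun y => f (y - x) + h y) (cocompact ℝ) atTop := by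
      have h1 : Tendsto (fun y : ℝ => ε * (|y| - |x| - 1) + h q) (cocompact ℝ) atTop := by
        have : Tendsto (fun y : ℝ => |y|) (cocompact ℝ) atTop := tendsto_norm_cocompact_atTop
        refine tendsto_atTop_add_const_right _ _ (Tendsto.const_mul_atTop hε ?_)
        simp only [sub_eq_add_neg]
        exact tendsto_atTop_add_const_right _ _ (tendsto_atTop_add_const_right _ _ this)
      refine tendsto_atTop_mono (fun y => ?_) h1
      have e1 := hlin (y - x)
      have e2 := abs_sub_abs_le_abs_sub y x
      have e3 : ε * (|y| - |x| - 1) ≤ ε * (|y - x| - 1) :=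
        mul_le_mul_of_nonneg_left (by linarith) hε.le
      have := hq y
      linarith
    obtain ⟨y, hy⟩ := hc.exists_forall_le hcoer
    refine ⟨y, fun z hz => lt_of_le_of_ne (hy z) fun heq => ?_⟩
    have e1 := hy ((z + y) / 2)
    have e2 := convexOn_univ_midpoint hh z y
    have e3 := convexOn_univ_midpoint hf.convex (z - x) (y - x)
    have e4 : (z - x + (y - x)) / 2 = (z + y) / 2 - x := by ring
    refine not_midAffine_of_strictConvexOn hf.strictConvex (x := z - x) (y := y - x)
      (fun h' => hz (by linarith)) (le_antisymm e3 ?_)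
    rw [e4]
    linarith
  choose r hr using key
  exact ⟨r, fun x z hz => hr x z hz⟩

namespace IsTarget

theorem le (hr : IsTarget (incr f) h r) (x z : ℝ) :
    f (r x - x) + h (r x) ≤ f (z - x) + h z := by
  rcases eq_or_ne z (r x) with rfl | hz
  · exact le_rfl
  · exact (hr x z hz).le

theorem eq_of_forall_le (hr : IsTarget (incr f) h r) {x z : ℝ}
    (hz : ∀ w, f (z - x) + h z ≤ f (w - x) + h w) : z = r x := by
  by_contra hne
  have e1 : f (r x - x) + h (r x) < f (z - x) + h z := hr x z hne
  have e2 := hz (r x)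
  linarith

theorem monotone (hr : IsTarget (incr f) h r) (hf : IncrementCost p f) : Monotone r := by
  intro p₁ p₂ hp
  by_contra! hlt
  have e1 : f (r p₁ - p₁) + h (r p₁) < f (r p₂ - p₁) + h (r p₂) := hr p₁ (r p₂) hlt.ne
  have e2 : f (r p₂ - p₂) + h (r p₂) < f (r p₁ - p₂) + h (r p₁) := hr p₂ (r p₁) hlt.ne'
  have := convexOn_univ_four_point hf.convex (a := r p₂ - p₂) (b := r p₁ - p₂) (c := r p₂ - p₁)
    (d := r p₁ - p₁) (by linarith) (by linarith) (by ring)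
  linarith

theorem sub_le (hr : IsTarget (incr f) h r) (hh : ConvexOn ℝ univ h) {p₁ p₂ : ℝ} (hp : p₁ ≤ p₂) :
    r p₂ - r p₁ ≤ p₂ - p₁ := by
  by_contra! hlt
  have e1 : f (r p₁ - p₁) + h (r p₁) <
      f (r p₂ - (p₂ - p₁) - p₁) + h (r p₂ - (p₂ - p₁)) := hr p₁ _ (by linarith)
  have e2 : f (r p₂ - p₂) + h (r p₂) <
      f (r p₁ + (p₂ - p₁) - p₂) + h (r p₁ + (p₂ - p₁)) := hr p₂ _ (by linarith)
  rw [show r p₂ - (p₂ - p₁) - p₁ = r p₂ - p₂ by ring] at e1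
  rw [show r p₁ + (p₂ - p₁) - p₂ = r p₁ - p₁ by ring] at e2
  have := convexOn_univ_four_point hh (a := r p₁) (b := r p₁ + (p₂ - p₁))
    (c := r p₂ - (p₂ - p₁)) (d := r p₂) (by linarith) (by linarith) (by ring)
  linarith

theorem continuous (hr : IsTarget (incr f) h r) (hf : IncrementCost p f)
    (hh : ConvexOn ℝ univ h) : Continuous r := by
  refine (LipschitzWith.of_le_add_mul 1 fun x y => ?_).continuous
  rw [Real.dist_eq, NNReal.coe_one, one_mul]
  rcases le_total x y with hxy | hxy
  · have := hr.monotone hf hxy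
    have := abs_nonneg (x - y)
    linarith
  · have := hr.sub_le hh hxy
    have := le_abs_self (x - y)
    linarith

theorem first_order (hr : IsTarget (incr f) h r) (hf : IncrementCost p f)
    (hd : Differentiable ℝ h) (x : ℝ) : deriv f (r x - x) + deriv h (r x) = 0 := by
  have h1 : HasDerivAt (fun y => f (y - x) + h y) (deriv f (r x - x) * 1 + deriv h (r x)) (r x) :=
    (((hf.differentiable (r x - x)).hasDerivAt.comp (r x)
      ((hasDerivAt_id (r x)).sub_const x))).add (hd (r x)).hasDerivAt
  have h2 : IsLocalMin (fun y => f (y - x) + h y) (r x) := Eventually.of_forall fun z => hr.le x z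
  simpa using h2.hasDerivAt_eq_zero h1

theorem strictMono (hr : IsTarget (incr f) h r) (hf : IncrementCost p f)
    (hd : Differentiable ℝ h) : StrictMono r := by
  intro p₁ p₂ hp
  refine lt_of_le_of_ne (hr.monotone hf hp.le) fun heq => ?_
  have e1 := hr.first_order hf hd p₁
  have e2 := hr.first_order hf hd p₂
  rw [← heq] at e2
  refine not_midAffine_of_strictConvexOn hf.strictConvex (x := r p₁ - p₁) (y := r p₁ - p₂)
    (by intro h'; linarith) (midAffine_of_deriv_eq hf.convex hf.differentiable (by linarith))

/-- The fixed points of the target function are the minimizers of `h`. -/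
theorem fixed_iff (hr : IsTarget (incr f) h r) (hf : IncrementCost p f)
    (hh : ConvexOn ℝ univ h) (hd : Differentiable ℝ h) (q : ℝ) :
    r q = q ↔ ∀ y, h q ≤ h y := by
  constructor
  · intro hq y
    have e1 := hr.first_order hf hd q
    have e2 : deriv f 0 = 0 := IsLocalMin.deriv_eq_zero
      (Eventually.of_forall fun z => by rw [hf.zero]; exact hf.nonneg z)
    rw [hq, sub_self, e2, zero_add] at e1
    have := support_line_deriv hh hd q y
    rw [e1] at this
    linarith
  · intro hq
    refine (hr.eq_of_forall_le fun w => ?_).symm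
    rw [sub_self, hf.zero]
    linarith [hq w, hf.nonneg (w - q)]

theorem project_le (hr : IsTarget (incr f) h r) (hf : IncrementCost p f)
    (hh : ConvexOn ℝ univ h) {l u x z : ℝ} (hz : z ∈ Icc l u) :
    f (min (max (r x) l) u - x) + h (min (max (r x) l) u) ≤ f (z - x) + h z :=
  le_of_project_minimizer (convexOn_objective hf hh x) (hr.le x) hz

/-- The orbits of the target function converge to minimizers of `h`. -/
theorem exists_tendsto_iterate (hr : IsTarget (incr f) h r) (hf : IncrementCost p f)
    (hh : ConvexOn ℝ univ h) (hd : Differentiable ℝ h) {q : ℝ} (hq : ∀ y, h q ≤ h y) (x : ℝ) :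
    ∃ q', (∀ y, h q' ≤ h y) ∧ Tendsto (fun n => r^[n] x) atTop (𝓝 q') := by
  have hm := hr.monotone hf
  have hrq : r q = q := (hr.fixed_iff hf hh hd q).2 hq
  have hfix : ∀ n, r^[n] q = q := fun n => (Function.IsFixedPt.iterate hrq n)
  suffices h : ∃ q', Tendsto (fun n => r^[n] x) atTop (𝓝 q') by
    obtain ⟨q', hq'⟩ := h
    refine ⟨q', (hr.fixed_iff hf hh hd q').1 ?_, hq'⟩
    exact isFixedPt_of_tendsto_iterate hq' (hr.continuous hf hh).continuousAt
  rcases le_total x q with hxq | hxq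
  · have h1 : x ≤ r x := by
      have := hr.sub_le hh hxq
      rw [hrq] at this
      linarith
    refine ⟨_, tendsto_atTop_ciSup (hm.monotone_iterate_of_le_map h1) ⟨q, ?_⟩⟩
    rintro _ ⟨n, rfl⟩
    have := hm.iterate n hxq
    rwa [hfix] at this
  · have h1 : r x ≤ x := by
      have := hr.sub_le hh hxq
      rw [hrq] at this
      linarith
    refine ⟨_, tendsto_atTop_ciInf (hm.antitone_iterate_of_map_le h1) ⟨q, ?_⟩⟩
    rintro _ ⟨n, rfl⟩
    have := hm.iterate n hxq
    rwa [hfix] at this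

end IsTarget

end Target

/-! ### Relative value functions have no affine pieces -/

section StrictConvexity

variable {f h r : ℝ → ℝ} {lam : ℝ}

/-- The action of the reference rule with target `r` in the first period, after the action `x`. -/
noncomputable def ruleAction (S : Shocks Ω) (r : ℝ → ℝ) (x : ℝ) (ω : Ω) : ℝ :=
  min (max (r x) (S.lower 0 x ω)) (S.upper 0 x ω)

theorem IsTarget.stepValue_eq (hr : IsTarget (incr f) h r) (hf : IncrementCost p f)
    (hh : ConvexOn ℝ univ h) (x : ℝ) {ω : Ω} (hω : S.U 0 ω ≤ S.V 0 ω) :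
    stepValue S (incr f) h x ω = f (ruleAction S r x ω - x) + h (ruleAction S r x ω) :=
  le_antisymm (stepValue_le hf.continuous (continuous_of_convexOn_univ hh)
      (min_max_mem_Icc (Shocks.lower_le_upper hω x) (r x)))
    (le_stepValue hω fun _ hy => hr.project_le hf hh hy)

/-- If `h` is affine between `x` and `y`, then so is almost every realization of the minimized
value. As `f` is strictly convex, the next actions keep the distance `y - x`, and `h` is affine
between them. -/
theorem IsTarget.ae_midAffine_ruleAction (hS : TransitionDynamics μ 𝓕 S)
    (hf : IncrementCost p f) (hh : IsRelativeValue μ S p (incr f) lam h)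
    (hr : IsTarget (incr f) h r) {x y : ℝ} (hxy : MidAffine h x y) :
    ∀ᵐ ω ∂μ, ruleAction S r y ω - ruleAction S r x ω = y - x ∧
      MidAffine h (ruleAction S r x ω) (ruleAction S r y ω) := by
  set g : ℝ → Ω → ℝ := stepValue S (incr f) h with hg
  have hi := hh.integrable
  have i0 : Integrable (fun ω => (g x ω + g y ω) / 2) μ := ((hi x).add (hi y)).div_const 2
  have i1 : Integrable (fun ω => (g x ω + g y ω) / 2 - g ((x + y) / 2) ω) μ := i0.sub (hi _)
  have hnn : 0 ≤ᵐ[μ] fun ω => (g x ω + g y ω) / 2 - g ((x + y) / 2) ω := by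
    filter_upwards [hS.interval 0] with ω hω
    have := convexOn_univ_midpoint (convexOn_stepValue (S := S) hω hf.convex hh.convex) x y
    simp only [Pi.zero_apply, hg]
    linarith
  have hzero : ∫ ω, ((g x ω + g y ω) / 2 - g ((x + y) / 2) ω) ∂μ = 0 := by
    rw [integral_sub i0 (hi _), integral_div,
      integral_add (hi x) (hi y), ← hh.optimality, ← hh.optimality, ← hh.optimality]
    have : h ((x + y) / 2) = (h x + h y) / 2 := hxy
    linarith
  filter_upwards [(integral_eq_zero_iff_of_nonneg_ae hnn i1).1 hzero, hS.interval 0] with ω he hω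
  simp only [Pi.zero_apply, hg] at he
  rw [hr.stepValue_eq hf hh.convex x hω, hr.stepValue_eq hf hh.convex y hω] at he
  set X := ruleAction S r x ω with hX
  set Y := ruleAction S r y ω with hY
  have mX : X ∈ S.feasible 0 x ω := min_max_mem_Icc (Shocks.lower_le_upper hω x) (r x)
  have mY : Y ∈ S.feasible 0 y ω := min_max_mem_Icc (Shocks.lower_le_upper hω y) (r y)
  have mM := Shocks.convexCombo_mem_feasible (t := 1 / 2) (by norm_num) (by norm_num) mX mY
  rw [show (1 - 1 / 2) * X + 1 / 2 * Y = (X + Y) / 2 by ring,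
    show (1 - 1 / 2) * x + 1 / 2 * y = (x + y) / 2 by ring] at mM
  have e1 := stepValue_le hf.continuous hh.continuous mM
  have e2 := convexOn_univ_midpoint hf.convex (X - x) (Y - y)
  have e3 := convexOn_univ_midpoint hh.convex X Y
  have e4 : (X - x + (Y - y)) / 2 = (X + Y) / 2 - (x + y) / 2 := by ring
  rw [← e4] at e1
  constructor
  · by_contra hne
    refine not_midAffine_of_strictConvexOn hf.strictConvex (x := X - x) (y := Y - y)
      (fun h' => hne (by linarith)) (le_antisymm e2 ?_)
    linarith
  · exact le_antisymm e3 (by linarith)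

/-- If the next actions from `x < y` keep their distance although `A < 1`, then the feasible
interval does not bind. -/
theorem IsTarget.ruleAction_eq_of_lt_one (hr : IsTarget (incr f) h r) (hh : ConvexOn ℝ univ h)
    {x y : ℝ} (hxy : x < y) {ω : Ω} (hω : S.U 0 ω ≤ S.V 0 ω) (hA : S.A 0 ω < 1)
    (hd : ruleAction S r y ω - ruleAction S r x ω = y - x) :
    ruleAction S r x ω = r x ∧ ruleAction S r y ω = r y := by
  have hlip := hr.sub_le hh hxy.le
  have hl : S.lower 0 y ω - S.lower 0 x ω < y - x := by
    unfold Shocks.lower; nlinarith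
  have hu : S.upper 0 y ω - S.upper 0 x ω < y - x := by
    unfold Shocks.upper; nlinarith
  have hx := Shocks.lower_le_upper hω x
  have hy := Shocks.lower_le_upper hω y
  unfold ruleAction at hd ⊢
  rcases le_total (r x) (S.lower 0 x ω) with h1 | h1 <;>
  rcases le_total (r y) (S.lower 0 y ω) with h2 | h2 <;>
  rcases le_total (r x) (S.upper 0 x ω) with h3 | h3 <;>
  rcases le_total (r y) (S.upper 0 y ω) with h4 | h4 <;>
  simp only [max_eq_left, max_eq_right, min_eq_left, min_eq_right, h1, h2, h3, h4, hx, hy]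
    at hd ⊢ <;>
  constructor <;> first | trivial | linarith

theorem IsTarget.midAffine_target [IsProbabilityMeasure μ] (hS : TransitionDynamics μ 𝓕 S)
    (hp : LpStable μ S p) (hf : IncrementCost p f) (hh : IsRelativeValue μ S p (incr f) lam h)
    (hr : IsTarget (incr f) h r) {x y : ℝ} (hlt : x < y) (hxy : MidAffine h x y) :
    r y - r x = y - x ∧ MidAffine h (r x) (r y) := by
  have hfreq : ∃ᶠ ω in ae μ, S.A 0 ω < 1 := by
    intro hcon
    exact TransitionDynamics.not_ae_one_le_A hp (by simpa using hcon)
  obtain ⟨ω, hA, ⟨hd, hm⟩, hω⟩ := (hfreq.and_eventually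
    ((hr.ae_midAffine_ruleAction hS hf hh hxy).and (hS.interval 0))).exists
  obtain ⟨e1, e2⟩ := hr.ruleAction_eq_of_lt_one hh.convex hlt hω hA hd
  rw [e1, e2] at hd hm
  exact ⟨hd, hm⟩

/-- The orbits under the target function of the ends of an affine piece of `h` converge to
minimizers of `h` that have the same distance. -/
theorem IsTarget.exists_tendsto_of_midAffine [IsProbabilityMeasure μ]
    (hS : TransitionDynamics μ 𝓕 S) (hp : LpStable μ S p) (hf : IncrementCost p f)
    (hh : IsRelativeValue μ S p (incr f) lam h) (hr : IsTarget (incr f) h r) {x y : ℝ}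
    (hlt : x < y) (hxy : MidAffine h x y) :
    ∃ q, (∀ z, h q ≤ h z) ∧ (∀ z, h (q + (y - x)) ≤ h z) ∧
      Tendsto (fun n => r^[n] x) atTop (𝓝 q) ∧
      Tendsto (fun n => r^[n] y) atTop (𝓝 (q + (y - x))) := by
  obtain ⟨⟨q₀, hq₀⟩, -⟩ := hh.exists_min hS hp hf
  have hd := hh.differentiable hS hp hf
  obtain ⟨q, hq, hlim⟩ := hr.exists_tendsto_iterate hf hh.convex hd hq₀ x
  obtain ⟨q', hq', hlim'⟩ := hr.exists_tendsto_iterate hf hh.convex hd hq₀ y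
  have hiter : ∀ n, r^[n] y = r^[n] x + (y - x) ∧ MidAffine h (r^[n] x) (r^[n] y) := by
    intro n
    induction n with
    | zero => exact ⟨by simp, hxy⟩
    | succ n ih =>
      obtain ⟨e1, e2⟩ := hr.midAffine_target hS hp hf hh (by linarith [ih.1]) ih.2
      rw [Function.iterate_succ_apply', Function.iterate_succ_apply']
      exact ⟨by linarith [ih.1], e2⟩
  have hl2 : Tendsto (fun n => r^[n] y) atTop (𝓝 (q + (y - x))) := by
    simp only [fun n => (hiter n).1]
    exact hlim.add_const _
  obtain rfl := tendsto_nhds_unique hlim' hl2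
  exact ⟨q, hq, hq', hlim, hl2⟩

/-- If `h` had an affine piece, then the
minimizers of `h` would form an interval `[a, b]` with `a < b`. Not both of `a` and `b` can be kept
forever, so with positive probability the reference rule shifts both by the same nonzero amount.
The shifted points are again the ends of an affine piece, so that their orbits converge to two
minimizers at distance `b - a`, that is to `a` and `b`. This is impossible, as the orbits are
monotone in the starting point and minimizers are fixed points. -/
theorem IsTarget.not_midAffine [IsProbabilityMeasure μ] (hS : TransitionDynamics μ 𝓕 S)
    (hp : LpStable μ S p) (hf : IncrementCost p f) (hh : IsRelativeValue μ S p (incr f) lam h)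
    (hr : IsTarget (incr f) h r)
    (hnoise : {x : ℝ | ∀ᵐ ω ∂μ, x ∈ S.feasible 0 x ω}.Subsingleton) {x y : ℝ} (hlt : x < y) :
    ¬ MidAffine h x y := by
  intro hxy
  have hd := hh.differentiable hS hp hf
  have hm := hr.monotone hf
  obtain ⟨⟨q₀, hq₀⟩, lo, hi, hbdd⟩ := hh.exists_min hS hp hf
  obtain ⟨q, hq, hq', -, -⟩ := hr.exists_tendsto_of_midAffine hS hp hf hh hlt hxy
  have hcomp : IsCompact {q | ∀ y, h q ≤ h y} := by
    refine (isCompact_Icc (a := lo) (b := hi)).of_isClosed_subset ?_ hbdd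
    have : {q | ∀ y, h q ≤ h y} = ⋂ y, {q | h q ≤ h y} := by ext; simp
    rw [this]
    exact isClosed_iInter fun y => isClosed_le hh.continuous continuous_const
  obtain ⟨a, ha, hal⟩ := hcomp.exists_isLeast ⟨q, hq⟩
  obtain ⟨b, hb, hbu⟩ := hcomp.exists_isGreatest ⟨q, hq⟩
  have ha : ∀ y, h a ≤ h y := ha
  have hb : ∀ y, h b ≤ h y := hb
  have hal : ∀ q, (∀ y, h q ≤ h y) → a ≤ q := fun q hq => hal hq
  have hbu : ∀ q, (∀ y, h q ≤ h y) → q ≤ b := fun q hq => hbu hq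
  have hab : a < b := by
    have := hal q hq
    have := hbu _ hq'
    linarith
  have hbetween : ∀ c, a ≤ c → c ≤ b → ∀ n, r^[n] c = c := by
    intro c h1 h2 n
    have hc : ∀ y, h c ≤ h y := fun y =>
      (hh.convex.le_max_of_mem_Icc (mem_univ a) (mem_univ b) ⟨h1, h2⟩).trans
        (max_le (ha y) (hb y))
    exact Function.IsFixedPt.iterate ((hr.fixed_iff hf hh.convex hd c).2 hc) n
  have habm : MidAffine h a b := by
    have e1 := convexOn_univ_midpoint hh.convex a b
    have e2 := ha ((a + b) / 2)
    have e3 := hb ((a + b) / 2)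
    exact le_antisymm e1 (by linarith)
  have hae := (hr.ae_midAffine_ruleAction hS hf hh habm).and (hS.interval 0)
  by_cases hstay : ∀ᵐ ω ∂μ, ruleAction S r a ω = a
  · have h1 : ∀ᵐ ω ∂μ, a ∈ S.feasible 0 a ω := by
      filter_upwards [hstay, hae] with ω hs ⟨_, hω⟩
      have : ruleAction S r a ω ∈ S.feasible 0 a ω :=
        min_max_mem_Icc (Shocks.lower_le_upper hω a) (r a)
      rwa [hs] at this
    have h2 : ∀ᵐ ω ∂μ, b ∈ S.feasible 0 b ω := by
      filter_upwards [hstay, hae] with ω hs ⟨⟨hdist, _⟩, hω⟩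
      have : ruleAction S r b ω ∈ S.feasible 0 b ω :=
        min_max_mem_Icc (Shocks.lower_le_upper hω b) (r b)
      rwa [show ruleAction S r b ω = b by linarith] at this
    exact hab.ne (hnoise h1 h2)
  · obtain ⟨ω, hne, ⟨hdist, haff⟩, -⟩ :=
      ((not_eventually.1 hstay).and_eventually hae).exists
    set a' := ruleAction S r a ω with ha'
    set b' := ruleAction S r b ω with hb'
    obtain ⟨q₁, hq₁, hq₁', l1, l2⟩ :=
      hr.exists_tendsto_of_midAffine hS hp hf hh (by linarith : a' < b') haff
    have hq₁a : q₁ = a := by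
      have := hal q₁ hq₁
      have := hbu _ hq₁'
      linarith
    rw [hdist, hq₁a, add_sub_cancel] at l2
    rw [hq₁a] at l1
    rcases lt_or_gt_of_ne hne with hlt' | hgt'
    · have hle : b ≤ max b' a := le_of_tendsto' l2 fun n => by
        have := hm.iterate n (le_max_left b' a)
        rwa [hbetween _ (le_max_right _ _) (max_le (by linarith) hab.le)] at this
      rcases le_max_iff.1 hle with h' | h' <;> linarith
    · have hle : min a' b ≤ a := ge_of_tendsto' l1 fun n => by
        have := hm.iterate n (min_le_left a' b)
        rwa [hbetween _ (le_min hgt'.le hab.le) (min_le_right _ _)] at this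
      rcases min_le_iff.1 hle with h' | h' <;> linarith

end StrictConvexity

/-! ### Moments of admissible action processes -/

section Moments

theorem TransitionDynamics.indepFun_vec (hS : TransitionDynamics μ 𝓕 S) {n : ℕ} {X : Ω → ℝ}
    (hX : Measurable[𝓕 n] X) : IndepFun X (S.vec n) μ := by
  rw [IndepFun_iff_Indep]
  exact (indep_of_indep_of_le_right (hS.indep n) hX.comap_le).symm

theorem lpNorm_eq_of_identDistrib {X Y : Ω → ℝ} {q : ℝ≥0∞} (h : IdentDistrib X Y μ μ) :
    lpNorm X q μ = lpNorm Y q μ := by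
  rw [← toReal_eLpNorm h.aemeasurable_fst.aestronglyMeasurable,
    ← toReal_eLpNorm h.aemeasurable_snd.aestronglyMeasurable, h.eLpNorm_eq]

theorem memLp_mul_of_indepFun (hp : 0 < p) {X Y : Ω → ℝ} (hX : MemLp X (ENNReal.ofReal p) μ)
    (hY : MemLp Y (ENNReal.ofReal p) μ) (hXY : IndepFun X Y μ) :
    MemLp (fun ω => X ω * Y ω) (ENNReal.ofReal p) μ ∧
      lpNorm (fun ω => X ω * Y ω) (ENNReal.ofReal p) μ =
        lpNorm X (ENNReal.ofReal p) μ * lpNorm Y (ENNReal.ofReal p) μ := by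
  have hp0 : ENNReal.ofReal p ≠ 0 := by simpa using hp
  have hmeas : Measurable fun z : ℝ => |z| ^ p := by
    simp only [← Real.norm_eq_abs]
    fun_prop
  have hind : IndepFun (fun ω => |X ω| ^ p) (fun ω => |Y ω| ^ p) μ := hXY.comp hmeas hmeas
  have iX := integrable_rpow_of_memLp hp hX
  have iY := integrable_rpow_of_memLp hp hY
  have e : (fun ω => |X ω| ^ p * |Y ω| ^ p) = fun ω => |X ω * Y ω| ^ p := by
    funext ω
    rw [abs_mul, Real.mul_rpow (abs_nonneg _) (abs_nonneg _)]
  have iXY : Integrable (fun ω => |X ω * Y ω| ^ p) μ := by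
    rw [← e]
    exact hind.integrable_mul iX iY
  have hmul : ∫ ω, |X ω * Y ω| ^ p ∂μ = (∫ ω, |X ω| ^ p ∂μ) * ∫ ω, |Y ω| ^ p ∂μ := by
    rw [← e]
    exact hind.integral_fun_mul_eq_mul_integral iX.aestronglyMeasurable iY.aestronglyMeasurable
  have hsm : AEStronglyMeasurable (fun ω => X ω * Y ω) μ :=
    hX.aestronglyMeasurable.mul hY.aestronglyMeasurable
  refine ⟨(integrable_norm_rpow_iff hsm hp0 (by simp)).1 ?_, ?_⟩
  · simpa [ENNReal.toReal_ofReal hp.le, abs_mul] using iXY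
  · have h1 : 0 ≤ ∫ ω, |X ω| ^ p ∂μ := integral_nonneg fun ω => by positivity
    have h2 : 0 ≤ ∫ ω, |Y ω| ^ p ∂μ := integral_nonneg fun ω => by positivity
    rw [lpNorm_eq_integral_norm_rpow_toReal hp0 (by simp) hsm,
      lpNorm_eq_integral_norm_rpow_toReal hp0 (by simp) hX.aestronglyMeasurable,
      lpNorm_eq_integral_norm_rpow_toReal hp0 (by simp) hY.aestronglyMeasurable,
      ENNReal.toReal_ofReal hp.le]
    simp only [Real.norm_eq_abs]
    rw [← Real.mul_rpow h1 h2, ← hmul]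

/-- One period of the dynamics in the `p`-th norm, for any feasible next action. -/
theorem TransitionDynamics.memLp_feasible (hS : TransitionDynamics μ 𝓕 S) (hp : LpStable μ S p)
    {n : ℕ} {X Y : Ω → ℝ} (hXm : Measurable[𝓕 n] X) (hX : MemLp X (ENNReal.ofReal p) μ)
    (hY : AEStronglyMeasurable Y μ) (hXY : ∀ᵐ ω ∂μ, Y ω ∈ S.feasible n (X ω) ω) :
    MemLp Y (ENNReal.ofReal p) μ ∧ lpNorm Y (ENNReal.ofReal p) μ ≤
      lpNorm (S.A 0) (ENNReal.ofReal p) μ * lpNorm X (ENNReal.ofReal p) μ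
        + lpNorm (S.drift 0) (ENNReal.ofReal p) μ := by
  have h2 := hp.two_le
  have h1 : 1 ≤ ENNReal.ofReal p := by simp; linarith
  have hind : IndepFun (fun ω => |S.A n ω|) (fun ω => |X ω|) μ :=
    (hS.indepFun_vec hXm).symm.comp (φ := fun v : ℝ × ℝ × ℝ × ℝ => ‖v.1‖) (ψ := fun x : ℝ => ‖x‖)
      (by fun_prop) (by fun_prop)
  obtain ⟨m1, e1⟩ := memLp_mul_of_indepFun (by linarith : 0 < p) (hS.memLp_abs_A hp n) hX.norm hind
  have m2 := hS.memLp_drift hp n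
  have hle : ∀ᵐ ω ∂μ, |Y ω| ≤ |S.A n ω| * |X ω| + S.drift n ω := by
    filter_upwards [hXY] with ω hω using Shocks.abs_le_of_mem_feasible hω
  have m3 : MemLp (fun ω => |S.A n ω| * |X ω| + S.drift n ω) (ENNReal.ofReal p) μ := m1.add m2
  refine ⟨m3.mono' hY hle, (lpNorm_mono_ae hY m3 hle).trans ?_⟩
  have e2 := lpNorm_add_le (g := S.drift n) m1 h1
  have e3 : lpNorm (fun ω => ‖X ω‖) (ENNReal.ofReal p) μ = lpNorm X (ENNReal.ofReal p) μ :=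
    lpNorm_fun_abs hX.aestronglyMeasurable _
  rw [e1, lpNorm_fun_abs (hS.measurable_A n).aestronglyMeasurable, e3,
    lpNorm_eq_of_identDistrib (hS.identDistrib_A n),
    lpNorm_eq_of_identDistrib (hS.identDistrib_drift n)] at e2
  exact e2

theorem IsAdmissible.measurable {x : ℝ} {P : ℕ → Ω → ℝ} (hP : IsAdmissible μ 𝓕 S x P) (n : ℕ) :
    Measurable (P n) := (hP.adapted n).mono (𝓕.le n) le_rfl

/-- Under every admissible action process the `p`-th moments stay bounded. -/
theorem IsAdmissible.memLp [IsProbabilityMeasure μ] (hS : TransitionDynamics μ 𝓕 S)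
    (hp : LpStable μ S p) {x : ℝ} {P : ℕ → Ω → ℝ} (hP : IsAdmissible μ 𝓕 S x P) :
    ∃ M, ∀ n, MemLp (P n) (ENNReal.ofReal p) μ ∧ lpNorm (P n) (ENNReal.ofReal p) μ ≤ M := by
  have h2 := hp.two_le
  have hα := hS.lpNorm_A_lt_one hp
  set α := lpNorm (S.A 0) (ENNReal.ofReal p) μ with hαdef
  set ρ := lpNorm (S.drift 0) (ENNReal.ofReal p) μ with hρdef
  have hα0 : 0 ≤ α := lpNorm_nonneg
  have hρ0 : 0 ≤ ρ := lpNorm_nonneg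
  have h1α : 0 < 1 - α := by linarith
  refine ⟨|x| + ρ / (1 - α), fun n => ?_⟩
  induction n with
  | zero =>
    have m : MemLp (fun _ : Ω => |x|) (ENNReal.ofReal p) μ := memLp_const _
    have hle : ∀ᵐ ω ∂μ, |P 0 ω| ≤ |x| := by
      filter_upwards [hP.initial] with ω hω
      rw [hω]
    have hm := (hP.measurable 0).aestronglyMeasurable (μ := μ)
    refine ⟨m.mono' hm hle, (lpNorm_mono_ae hm m hle).trans ?_⟩
    rw [lpNorm_const (by simp; linarith) (IsProbabilityMeasure.ne_zero μ)]
    have : 0 ≤ ρ / (1 - α) := by positivity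
    simp
    linarith
  | succ n ih =>
    obtain ⟨m, hle⟩ := hS.memLp_feasible hp (hP.adapted n) ih.1
      (hP.measurable (n + 1)).aestronglyMeasurable (hP.feasible n)
    refine ⟨m, hle.trans ?_⟩
    have e : ρ = ρ / (1 - α) * (1 - α) := by field_simp
    have := mul_le_mul_of_nonneg_left ih.2 hα0
    have := mul_nonneg h1α.le (abs_nonneg x)
    nlinarith

theorem integrable_comp_of_growth [IsProbabilityMeasure μ] (hp : 1 ≤ p) {h : ℝ → ℝ}
    (hh : Continuous h) {C : ℝ} (hC : ∀ z, |h z| ≤ C * (1 + |z|) ^ p) {X : Ω → ℝ}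
    (hX : MemLp X (ENNReal.ofReal p) μ) :
    Integrable (fun ω => h (X ω)) μ ∧
      |∫ ω, h (X ω) ∂μ| ≤ C * (1 + lpNorm X (ENNReal.ofReal p) μ) ^ p := by
  have hp0 : 0 < p := by linarith
  have h1 : 1 ≤ ENNReal.ofReal p := by simpa using hp
  have hC0 : 0 ≤ C := by simpa using (abs_nonneg (h 0)).trans (hC 0)
  have m1 : MemLp (fun _ : Ω => (1 : ℝ)) (ENNReal.ofReal p) μ := memLp_const 1
  have m : MemLp (fun ω => 1 + |X ω|) (ENNReal.ofReal p) μ := m1.add hX.norm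
  have i1 : Integrable (fun ω => (1 + |X ω|) ^ p) μ := by
    refine (integrable_rpow_of_memLp hp0 m).congr (ae_of_all _ fun ω => ?_)
    simp only
    rw [abs_of_nonneg (by positivity)]
  have hle : ∀ᵐ ω ∂μ, ‖h (X ω)‖ ≤ C * (1 + |X ω|) ^ p := ae_of_all _ fun ω => hC (X ω)
  have i2 : Integrable (fun ω => h (X ω)) μ :=
    (i1.const_mul C).mono' (hh.comp_aestronglyMeasurable hX.aestronglyMeasurable) hle
  refine ⟨i2, ?_⟩
  have e1 := norm_integral_le_of_norm_le (i1.const_mul C) hle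
  rw [integral_const_mul, Real.norm_eq_abs] at e1
  refine e1.trans (mul_le_mul_of_nonneg_left ?_ hC0)
  have e2 := lpNorm_rpow_eq hp0 m.aestronglyMeasurable
  have e3 : ∫ ω, |(1 + |X ω|)| ^ p ∂μ = ∫ ω, (1 + |X ω|) ^ p ∂μ := by
    refine integral_congr_ae (ae_of_all _ fun ω => ?_)
    simp only
    rw [abs_of_nonneg (by positivity)]
  rw [← e3, ← e2]
  refine Real.rpow_le_rpow lpNorm_nonneg ?_ hp0.le
  have e4 := lpNorm_add_le (g := fun ω => |X ω|) m1 h1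
  rw [lpNorm_fun_abs hX.aestronglyMeasurable] at e4
  refine e4.trans (add_le_add ?_ le_rfl)
  rw [lpNorm_const (by simp; linarith) (IsProbabilityMeasure.ne_zero μ)]
  simp

end Moments

/-! ### Optimality of the reference rule -/

section Optimality

variable {f h r : ℝ → ℝ} {lam : ℝ}

/-- The projection of `r x` onto the feasible interval with coefficients `v = (A, B, U, V)`. -/
noncomputable def projectOnto (r : ℝ → ℝ) (q : ℝ × ℝ × ℝ × ℝ × ℝ) : ℝ :=
  min (max (r q.1) (q.2.1 * q.1 + q.2.2.1 + q.2.2.2.1)) (q.2.1 * q.1 + q.2.2.1 + q.2.2.2.2)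

theorem continuous_projectOnto (hr : Continuous r) : Continuous (projectOnto r) := by
  unfold projectOnto
  fun_prop

theorem projectOnto_mem_feasible {n : ℕ} {ω : Ω} (hω : S.U n ω ≤ S.V n ω) (x : ℝ) :
    projectOnto r (x, S.vec n ω) ∈ S.feasible n x ω :=
  min_max_mem_Icc (Shocks.lower_le_upper hω x) (r x)

theorem isAdmissible_rulePath (hS : TransitionDynamics μ 𝓕 S) (hr : Continuous r) (x : ℝ) :
    IsAdmissible μ 𝓕 S x (rulePath S r x) where
  initial := ae_of_all _ fun _ => rfl
  adapted n := by
    induction n with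
    | zero => exact measurable_const
    | succ n ih =>
      have h1 : Measurable[𝓕 (n + 1)] (rulePath S r x n) := ih.mono (𝓕.mono n.le_succ) le_rfl
      exact (continuous_projectOnto hr).measurable.comp (h1.prodMk (hS.adapted n))
  feasible n := by
    filter_upwards [hS.interval n] with ω hω
    exact projectOnto_mem_feasible hω _

/-- The optimality equation along an adapted process: the next coefficients are independent of the
current action, so the expectation over them can be taken first. -/
theorem IsRelativeValue.integral_project [IsProbabilityMeasure μ]
    (hS : TransitionDynamics μ 𝓕 S) (hp : LpStable μ S p)
    (hf : IncrementCost p f) (hh : IsRelativeValue μ S p (incr f) lam h)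
    (hr : IsTarget (incr f) h r) {n : ℕ} {X : Ω → ℝ} (hXm : Measurable[𝓕 n] X)
    (hX : MemLp X (ENNReal.ofReal p) μ) :
    Integrable (fun ω => f (projectOnto r (X ω, S.vec n ω) - X ω)
        + h (projectOnto r (X ω, S.vec n ω))) μ ∧
      ∫ ω, (f (projectOnto r (X ω, S.vec n ω) - X ω)
        + h (projectOnto r (X ω, S.vec n ω))) ∂μ = lam + ∫ ω, h (X ω) ∂μ := by
  have h2 := hp.two_le
  have hp1 : 1 ≤ p := by linarith
  obtain ⟨L, hL⟩ := hf.hasGrowth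
  obtain ⟨C, hC⟩ := HasGrowth.of_le (by linarith : 0 ≤ p) hh.growth
  have hrc := hr.continuous hf hh.convex
  have hpc := continuous_projectOnto hrc
  have hXm' : Measurable X := hXm.mono (𝓕.le n) le_rfl
  have hvm := hS.measurable_vec
  set Γ : ℝ × ℝ × ℝ × ℝ × ℝ → ℝ := fun q => f (projectOnto r q - q.1) + h (projectOnto r q) with hΓ
  have hΓc : Continuous Γ := by
    have := hf.continuous
    have := hh.continuous
    fun_prop
  have hpair : Measurable fun ω => (X ω, S.vec n ω) := hXm'.prodMk (hvm n)
  obtain ⟨mF, -⟩ := hS.memLp_feasible hp hXm hX (Y := fun ω => projectOnto r (X ω, S.vec n ω))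
    (hpc.measurable.comp hpair).aestronglyMeasurable (by
      filter_upwards [hS.interval n] with ω hω using projectOnto_mem_feasible hω _)
  have hi : Integrable (fun ω => Γ (X ω, S.vec n ω)) μ :=
    (integrable_comp_of_growth hp1 hf.continuous hL (mF.sub hX)).1.add
      (integrable_comp_of_growth hp1 hh.continuous hC mF).1
  refine ⟨hi, ?_⟩
  have hlaw : μ.map (fun ω => (X ω, S.vec n ω)) = (μ.map X).prod (μ.map (S.vec 0)) := by
    rw [(indepFun_iff_map_prod_eq_prod_map_map hXm'.aemeasurable (hvm n).aemeasurable).1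
      (hS.indepFun_vec hXm), (hS.identDistrib n).map_eq]
  have : IsProbabilityMeasure (μ.map X) := Measure.isProbabilityMeasure_map hXm'.aemeasurable
  have : IsProbabilityMeasure (μ.map (S.vec 0)) :=
    Measure.isProbabilityMeasure_map (hvm 0).aemeasurable
  have hi' : Integrable Γ ((μ.map X).prod (μ.map (S.vec 0))) := by
    rw [← hlaw]
    exact (integrable_map_measure hΓc.aestronglyMeasurable hpair.aemeasurable).2 hi
  have hinner : ∀ x, ∫ v, Γ (x, v) ∂(μ.map (S.vec 0)) = lam + h x := by
    intro x
    have hm : AEStronglyMeasurable (fun v => Γ (x, v)) (μ.map (S.vec 0)) :=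
      (hΓc.comp (Continuous.prodMk_right x)).aestronglyMeasurable
    rw [integral_map (hvm 0).aemeasurable hm, hh.optimality x]
    refine integral_congr_ae ?_
    filter_upwards [hS.interval 0] with ω hω
    exact (hr.stepValue_eq hf hh.convex x hω).symm
  calc ∫ ω, Γ (X ω, S.vec n ω) ∂μ
      = ∫ q, Γ q ∂(μ.map fun ω => (X ω, S.vec n ω)) :=
        (integral_map hpair.aemeasurable hΓc.aestronglyMeasurable).symm
    _ = ∫ x, (lam + h x) ∂(μ.map X) := by
        rw [hlaw, integral_prod _ hi']
        simp only [hinner]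
    _ = ∫ ω, (lam + h (X ω)) ∂μ :=
        integral_map hXm'.aemeasurable (continuous_const.add hh.continuous).aestronglyMeasurable
    _ = lam + ∫ ω, h (X ω) ∂μ := by
        rw [integral_add (integrable_const _)
          (integrable_comp_of_growth hp1 hh.continuous hC hX).1]
        simp

/-- The expected cost of one period is at least `lam` plus the expected decrease of `h`, because the
next action is one of the candidates in the minimization. The reference rule attains the minimum. -/
theorem IsAdmissible.expected_cost [IsProbabilityMeasure μ]
    (hS : TransitionDynamics μ 𝓕 S) (hp : LpStable μ S p)
    (hf : IncrementCost p f) (hh : IsRelativeValue μ S p (incr f) lam h)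
    (hr : IsTarget (incr f) h r) {x : ℝ} {P : ℕ → Ω → ℝ} (hP : IsAdmissible μ 𝓕 S x P) (n : ℕ) :
    Integrable (fun ω => f (P (n + 1) ω - P n ω)) μ ∧
    lam + ∫ ω, h (P n ω) ∂μ - ∫ ω, h (P (n + 1) ω) ∂μ ≤ ∫ ω, f (P (n + 1) ω - P n ω) ∂μ ∧
    ((∀ ω, P (n + 1) ω = projectOnto r (P n ω, S.vec n ω)) →
      ∫ ω, f (P (n + 1) ω - P n ω) ∂μ =
        lam + ∫ ω, h (P n ω) ∂μ - ∫ ω, h (P (n + 1) ω) ∂μ) := by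
  have h2 := hp.two_le
  have hp1 : 1 ≤ p := by linarith
  obtain ⟨L, hL⟩ := hf.hasGrowth
  obtain ⟨C, hC⟩ := HasGrowth.of_le (by linarith : 0 ≤ p) hh.growth
  obtain ⟨M, hM⟩ := hP.memLp hS hp
  obtain ⟨iG, eG⟩ := hh.integral_project hS hp hf hr (hP.adapted n) (hM n).1
  have ic : Integrable (fun ω => f (P (n + 1) ω - P n ω)) μ :=
    (integrable_comp_of_growth hp1 hf.continuous hL ((hM (n + 1)).1.sub (hM n).1)).1
  have ih : Integrable (fun ω => h (P (n + 1) ω)) μ :=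
    (integrable_comp_of_growth hp1 hh.continuous hC (hM (n + 1)).1).1
  have esum : ∫ ω, (f (P (n + 1) ω - P n ω) + h (P (n + 1) ω)) ∂μ =
      ∫ ω, f (P (n + 1) ω - P n ω) ∂μ + ∫ ω, h (P (n + 1) ω) ∂μ := integral_add ic ih
  refine ⟨ic, ?_, fun heq => ?_⟩
  · have hle := integral_mono_ae iG (ic.add ih) (by
      filter_upwards [hP.feasible n] with ω hω
      exact hr.project_le hf hh.convex hω)
    simp only [Pi.add_apply] at hle
    linarith
  · simp only [← heq] at eG
    linarith

theorem longRunCost_term_eq {P : ℕ → Ω → ℝ} (hf : IncrementCost p f)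
    (hi : ∀ n, Integrable (fun ω => f (P (n + 1) ω - P n ω)) μ) {T : ℕ} (hT : 0 < T) :
    (∑ t ∈ Finset.range T, ∫⁻ ω, ENNReal.ofReal (incr f (P t ω) (P (t + 1) ω)) ∂μ) / (T : ℝ≥0∞) =
      ENNReal.ofReal ((∑ t ∈ Finset.range T, ∫ ω, f (P (t + 1) ω - P t ω) ∂μ) / T) := by
  have hT' : (0 : ℝ) < T := by exact_mod_cast hT
  rw [ENNReal.ofReal_div_of_pos hT', ENNReal.ofReal_natCast,
    ENNReal.ofReal_sum_of_nonneg fun t _ => integral_nonneg fun ω => hf.nonneg _]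
  congr 1
  refine Finset.sum_congr rfl fun t _ => ?_
  exact (ofReal_integral_eq_lintegral_ofReal (hi t) (ae_of_all _ fun ω => hf.nonneg _)).symm

theorem IsTarget.isOptimalRule [IsProbabilityMeasure μ]
    (hS : TransitionDynamics μ 𝓕 S) (hp : LpStable μ S p)
    (hf : IncrementCost p f) (hh : IsRelativeValue μ S p (incr f) lam h)
    (hr : IsTarget (incr f) h r) : IsOptimalRule μ 𝓕 S (incr f) r := by
  intro x
  have h2 := hp.two_le
  have hp1 : 1 ≤ p := by linarith
  obtain ⟨C, hC⟩ := HasGrowth.of_le (by linarith : 0 ≤ p) hh.growth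
  have hC0 : 0 ≤ C := by simpa using (abs_nonneg (h 0)).trans (hC 0)
  have hadm := isAdmissible_rulePath hS (hr.continuous hf hh.convex) x
  -- the bounded terms of the telescoping sum vanish on average
  have hlim : ∀ P, IsAdmissible μ 𝓕 S x P →
      Tendsto (fun T : ℕ => lam + (∫ ω, h (P 0 ω) ∂μ - ∫ ω, h (P T ω) ∂μ) / T) atTop
        (𝓝 lam) := by
    intro P hP
    obtain ⟨M, hM⟩ := hP.memLp hS hp
    have hb : ∀ n, |∫ ω, h (P n ω) ∂μ| ≤ C * (1 + M) ^ p := fun n => by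
      refine (integrable_comp_of_growth hp1 hh.continuous hC (hM n).1).2.trans ?_
      refine mul_le_mul_of_nonneg_left (Real.rpow_le_rpow ?_ ?_ (by linarith)) hC0
      · have : 0 ≤ lpNorm (P n) (ENNReal.ofReal p) μ := lpNorm_nonneg
        linarith
      · linarith [(hM n).2]
    have h0 : Tendsto (fun T : ℕ => (∫ ω, h (P 0 ω) ∂μ - ∫ ω, h (P T ω) ∂μ) / (T : ℝ)) atTop
        (𝓝 0) := by
      refine squeeze_zero_norm (a := fun T : ℕ => 2 * (C * (1 + M) ^ p) / (T : ℝ)) (fun T => ?_)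
        (tendsto_const_div_atTop_nhds_zero_nat _)
      rw [norm_div, Real.norm_natCast, Real.norm_eq_abs]
      refine div_le_div_of_nonneg_right ?_ (Nat.cast_nonneg T)
      have := abs_sub (∫ ω, h (P 0 ω) ∂μ) (∫ ω, h (P T ω) ∂μ)
      linarith [hb 0, hb T]
    simpa using h0.const_add lam
  have htel : ∀ (P : ℕ → Ω → ℝ) (T : ℕ), 0 < T →
      (∑ t ∈ Finset.range T, (lam + ∫ ω, h (P t ω) ∂μ - ∫ ω, h (P (t + 1) ω) ∂μ)) / (T : ℝ) =
        lam + (∫ ω, h (P 0 ω) ∂μ - ∫ ω, h (P T ω) ∂μ) / T := by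
    intro P T hT
    have hT' : (T : ℝ) ≠ 0 := by exact_mod_cast hT.ne'
    simp only [add_sub_assoc]
    rw [Finset.sum_add_distrib, Finset.sum_range_sub' fun t => ∫ ω, h (P t ω) ∂μ]
    simp only [Finset.sum_const, Finset.card_range, nsmul_eq_mul]
    field_simp
  refine ⟨hadm, fun P hP => ?_⟩
  have hrule : longRunCost μ (incr f) (rulePath S r x) = ENNReal.ofReal lam := by
    refine Tendsto.limsup_eq (Tendsto.congr' ?_ (ENNReal.tendsto_ofReal (hlim _ hadm)))
    filter_upwards [eventually_gt_atTop 0] with T hT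
    rw [longRunCost_term_eq hf (fun n => (hadm.expected_cost hS hp hf hh hr n).1) hT, ← htel _ T hT]
    congr 2
    exact Finset.sum_congr rfl fun t _ =>
      ((hadm.expected_cost hS hp hf hh hr t).2.2 fun ω => rfl).symm
  rw [hrule, ← (ENNReal.tendsto_ofReal (hlim P hP)).limsup_eq]
  refine limsup_le_limsup ?_
  filter_upwards [eventually_gt_atTop 0] with T hT
  rw [longRunCost_term_eq hf (fun n => (hP.expected_cost hS hp hf hh hr n).1) hT, ← htel P T hT]
  refine ENNReal.ofReal_le_ofReal (div_le_div_of_nonneg_right ?_ (Nat.cast_nonneg T))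
  exact Finset.sum_le_sum fun t _ => (hP.expected_cost hS hp hf hh hr t).2.1

end Optimality

end ReferenceRule

open ReferenceRule
theorem theorem2 {Ω : Type*} {mΩ : MeasurableSpace Ω} (μ : Measure Ω) [IsProbabilityMeasure μ]
    (𝓕 : Filtration ℕ mΩ) (S : Shocks Ω) (p : ℝ) (c : ℝ → ℝ → ℝ)
    (hS : TransitionDynamics μ 𝓕 S) (hp : LpStable μ S p) (hc : AdjustmentCost p c)
    (hxy : ∀ x y, costXY c x y < 0) (hyy : ∀ x y, |costXY c x y| ≤ costYY c x y)
    (hnoise : {x : ℝ | ∀ᵐ ω ∂μ, x ∈ S.feasible 0 x ω}.Subsingleton) :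
    (∃ (lam : ℝ) (h : ℝ → ℝ), IsRelativeValue μ S p c lam h) ∧
    ∀ (lam : ℝ) (h : ℝ → ℝ), IsRelativeValue μ S p c lam h →
      ∃ r : ℝ → ℝ, IsTarget c h r ∧ IsOptimalRule μ 𝓕 S c r ∧
        StrictMono r ∧
        (∀ p₁ p₂, p₁ < p₂ → 0 ≤ r p₂ - r p₁ ∧ r p₂ - r p₁ < p₂ - p₁) ∧
        ∃ q : ℝ, r q = q ∧ (∀ q', r q' = q' → q' = q) ∧ ∀ y, y ≠ q → h q < h y := by
  have hf := hc.incrementCost hp.two_le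
  -- the cost depends on the increment only
  rw [hc.eq_increment]
  generalize c 0 = f at hf
  refine ⟨exists_isRelativeValue hS hp hf, fun lam h hh => ?_⟩
  obtain ⟨⟨q, hq⟩, -⟩ := hh.exists_min hS hp hf
  have hd := hh.differentiable hS hp hf
  obtain ⟨r, hr⟩ := exists_isTarget hf hh.convex hq
  have hstrict := hr.strictMono hf hd
  have hno := fun x y (hxy : x < y) => hr.not_midAffine hS hp hf hh hnoise hxy
  have hlt : ∀ p₁ p₂, p₁ < p₂ → r p₂ - r p₁ < p₂ - p₁ := by
    intro p₁ p₂ h12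
    refine lt_of_le_of_ne (hr.sub_le hh.convex h12.le) fun heq => ?_
    -- equality in the first-order conditions forces equal slopes of `h`, that is an affine piece
    have e1 := hr.first_order hf hd p₁
    have e2 := hr.first_order hf hd p₂
    rw [show r p₂ - p₂ = r p₁ - p₁ by linarith] at e2
    exact hno _ _ (hstrict h12) (midAffine_of_deriv_eq hh.convex hd (by linarith))
  have hfix := hr.fixed_iff hf hh.convex hd
  have hrq := (hfix q).2 hq
  have huniq : ∀ q', r q' = q' → q' = q := by
    intro q' hq'
    rcases lt_trichotomy q' q with h1 | h1 | h1
    · have := hlt _ _ h1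
      rw [hq', hrq] at this
      exact absurd this (lt_irrefl _)
    · exact h1
    · have := hlt _ _ h1
      rw [hq', hrq] at this
      exact absurd this (lt_irrefl _)
  refine ⟨r, hr, hr.isOptimalRule hS hp hf hh, hstrict,
    fun p₁ p₂ h12 => ⟨sub_nonneg.2 (hstrict h12).le, hlt p₁ p₂ h12⟩, q, hrq, huniq,
    fun y hy => lt_of_le_of_ne (hq y) fun heq => hy (huniq y ((hfix y).2 fun z => heq ▸ hq z))⟩
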